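/- **Setting.** Let $N\ge 3$ and let $D$ be a smooth domain on the unit sphere $\mathbb S^{N-1}\subset\mathbb R^N$ (nonempty, connected, relatively open, with smooth boundary; $D=\mathbb S^{N-1}$ is allowed). Put $$\Sigma_D=\{sq:\ q\in D,\ s>0\},\qquad S_D=\{sq:\ q\in D,\ 0<s<1\},\qquad \Gamma_1=\partial\Sigma_D\cap\partial S_D .$$ Let $H^1_0(S_D\cup\Gamma_1)$ be the completion of $C^1_c(S_D\cup\Gamma_1)$ with respect to the $H^1(S_D)$ norm. For $g:S_D\times\mathbb R\to\mathbb R$, a *positive weak solution* of $$-\Delta u=g(x,u)\ \text{in } S_D,\qquad \partial_\nu u=0\ \text{on }\Gamma_1,\qquad u=0\ \text{on } D,\qquad u>0\ \text{in } S_D \tag{1}$$ is a function $u\in H^1_0(S_D\cup\Gamma_1)$ with $u>0$ a.e. in $S_D$ such that, for all $v\in H^1_0(S_D\cup\Gamma_1)$, $g(x,u)v$ is integrable on $S_D$ and $$\int_{S_D}\big(\nabla u\cdot\nabla v-g(x,u)\,v\big)\,dx=0 .$$ **Proposition 3.1.** Let $0<\varepsilon<2$. (a) For every $M\ge 0$ there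 is a constant $C=C(N,D,\varepsilon,M)$ such that the following holds. Let $c_1,c_2\in L^{N/(2-\varepsilon)}(S_D)$ with $\|c_1\|_{L^{N/(2-\varepsilon)}(S_D)}\le M$, and let $u$ be a positive weak solution of (1), where $|g(x,u(x))|\le c_1(x)|u(x)|+c_2(x)$ for a.e. $x\in S_D$. Then $u\in L^\infty(S_D)$, and $$\|u\|_{L^\infty(S_D)}\le C\big\{\|u\|_{L^2(S_D)}+\|c_2\|_{L^\infty(S_D)}\big\},$$ where the right-hand side may be infinite if $c_2\notin L^\infty(S_D)$ (in that case the assertion is that $u$ is bounded). (b) In particular, let $f:\mathbb R\to\mathbb R$ be continuous, let $p<\frac{N+2}{N-2}$ and $c$ be real numbers, and let $b\in L^{N/(2-\varepsilon)}(S_D)$ be such that $|f(s)|\le c|s|^p+b(x)$ for a.e. $x\in S_D$ and all $s\ne 0$. Then every positive weak solution of (1) with $g(x,s)=f(s)$ is essentially bounded in $S_D$. -/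

import Mathlib

open MeasureTheory Filter Topology
open scoped ENNReal NNReal ContDiff

/-- A smooth domain `D` on the unit sphere of `ℝ^N`: a nonempty connected relatively open set which,
near each of its (relative) boundary points `q`, is one side `{ρ < 0}` of a smooth function `ρ`
whose differential at `q` does not vanish on the tangent space `q^⊥` of the sphere.
The whole sphere, which has no boundary, is allowed. -/
structure IsSmoothSphericalDomain {N : ℕ}
    (D : Set (Metric.sphere (0 : EuclideanSpace ℝ (Fin N)) 1)) : Prop where
  isOpen : IsOpen D
  isConnected : IsConnected D
  smooth_boundary : ∀ q ∈ frontier D,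
    ∃ (U : Set (EuclideanSpace ℝ (Fin N))) (ρ : EuclideanSpace ℝ (Fin N) → ℝ),
      IsOpen U ∧ (q : EuclideanSpace ℝ (Fin N)) ∈ U ∧ ContDiffOn ℝ ∞ ρ U ∧
      (∃ τ : EuclideanSpace ℝ (Fin N),
        inner ℝ (q : EuclideanSpace ℝ (Fin N)) τ = 0 ∧ fderiv ℝ ρ q τ ≠ 0) ∧
      ∀ y : Metric.sphere (0 : EuclideanSpace ℝ (Fin N)) 1,
        (y : EuclideanSpace ℝ (Fin N)) ∈ U → (y ∈ D ↔ ρ y < 0)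

/-- The open cone `Σ_D = {s q : q ∈ D, s > 0}` spanned by `D`. -/
def sphericalCone {N : ℕ} (D : Set (Metric.sphere (0 : EuclideanSpace ℝ (Fin N)) 1)) :
    Set (EuclideanSpace ℝ (Fin N)) :=
  {x | ∃ q ∈ D, ∃ s : ℝ, 0 < s ∧ x = s • (q : EuclideanSpace ℝ (Fin N))}

/-- The spherical sector `S_D = {s q : q ∈ D, 0 < s < 1}`. -/
def sphericalSector {N : ℕ} (D : Set (Metric.sphere (0 : EuclideanSpace ℝ (Fin N)) 1)) :
    Set (EuclideanSpace ℝ (Fin N)) :=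
  {x | ∃ q ∈ D, ∃ s : ℝ, 0 < s ∧ s < 1 ∧ x = s • (q : EuclideanSpace ℝ (Fin N))}

/-- The lateral boundary `Γ₁ = ∂Σ_D ∩ ∂S_D` of the sector; it contains the vertex. -/
def lateralBoundary {N : ℕ} (D : Set (Metric.sphere (0 : EuclideanSpace ℝ (Fin N)) 1)) :
    Set (EuclideanSpace ℝ (Fin N)) :=
  frontier (sphericalCone D) ∩ frontier (sphericalSector D)

/-- Lebesgue measure on the sector `S_D`. -/
noncomputable def sectorMeasure {N : ℕ}
    (D : Set (Metric.sphere (0 : EuclideanSpace ℝ (Fin N)) 1)) :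
    Measure (EuclideanSpace ℝ (Fin N)) :=
  volume.restrict (sphericalSector D)

/-- `φ` represents an element of `C_c^1(S_D ∪ Γ₁)`: it is `C^1` up to the boundary (given by a `C^1`
function on `ℝ^N`), and the support of its restriction to `S_D ∪ Γ₁` is a compact subset of
`S_D ∪ Γ₁` (closed and contained in `S_D ∪ Γ₁`; boundedness is automatic). There is no condition
on `Γ₁`, but `φ` vanishes near every point of `D` on the side of the sector. -/
def IsSectorC1c {N : ℕ} (D : Set (Metric.sphere (0 : EuclideanSpace ℝ (Fin N)) 1))
    (φ : EuclideanSpace ℝ (Fin N) → ℝ) : Prop :=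
  ContDiff ℝ 1 φ ∧
    closure ((sphericalSector D ∪ lateralBoundary D) ∩ Function.support φ) ⊆
      sphericalSector D ∪ lateralBoundary D

/-- `u` belongs to `H_0^1(S_D ∪ Γ₁)`, with gradient `Du`: the space is the completion of
`C_c^1(S_D ∪ Γ₁)` for the `H^1(S_D)` norm, that is, the pairs `(u, Du)` are the limits in
`L^2(S_D) × L^2(S_D)^N` of pairs `(φ, ∇φ)` with `φ ∈ C_c^1(S_D ∪ Γ₁)`. In particular `Du` is the weak
gradient of `u` in `S_D`, and is determined by `u` up to a null set. -/
def MemSectorH10 {N : ℕ} (D : Set (Metric.sphere (0 : EuclideanSpace ℝ (Fin N)) 1))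
    (u : EuclideanSpace ℝ (Fin N) → ℝ)
    (Du : EuclideanSpace ℝ (Fin N) → EuclideanSpace ℝ (Fin N)) : Prop :=
  MemLp u 2 (sectorMeasure D) ∧ MemLp Du 2 (sectorMeasure D) ∧
    ∃ φ : ℕ → EuclideanSpace ℝ (Fin N) → ℝ,
      (∀ n, IsSectorC1c D (φ n)) ∧
      Tendsto (fun n => eLpNorm (fun x => φ n x - u x) 2 (sectorMeasure D)) atTop (𝓝 0) ∧
      Tendsto (fun n => eLpNorm (fun x => gradient (φ n) x - Du x) 2 (sectorMeasure D))
        atTop (𝓝 0)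

/-- `u ∈ H_0^1(S_D ∪ Γ₁)` is a positive weak solution of `-Δu = g(x,u)` in `S_D`, `∂_ν u = 0` on `Γ₁`,
`u = 0` on `D`: it satisfies `∫ (∇u · ∇v - g(x,u) v) dx = 0` for all `v ∈ H_0^1(S_D ∪ Γ₁)`, where the
integrals make sense, and `u > 0` almost everywhere in `S_D`. -/
def IsPositiveWeakSolution {N : ℕ} (D : Set (Metric.sphere (0 : EuclideanSpace ℝ (Fin N)) 1))
    (g : EuclideanSpace ℝ (Fin N) → ℝ → ℝ) (u : EuclideanSpace ℝ (Fin N) → ℝ) : Prop :=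
  ∃ Du : EuclideanSpace ℝ (Fin N) → EuclideanSpace ℝ (Fin N),
    MemSectorH10 D u Du ∧
    (∀ᵐ x ∂(sectorMeasure D), 0 < u x) ∧
    ∀ (v : EuclideanSpace ℝ (Fin N) → ℝ)
      (Dv : EuclideanSpace ℝ (Fin N) → EuclideanSpace ℝ (Fin N)), MemSectorH10 D v Dv →
      Integrable (fun x => g x (u x) * v x) (sectorMeasure D) ∧
      ∫ x, (inner ℝ (Du x) (Dv x) - g x (u x) * v x) ∂(sectorMeasure D) = 0

/-! The bound is a De Giorgi–Stampacchia level-set argument; the geometry of the sector enters only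
through the Sobolev inequality `‖u‖_{2N/(N-2)} ≤ C ‖∇u‖_2` on `H_0^1(S_D ∪ Γ₁)`.

Sobolev inequality. Extended by zero, a function of `C_c^1(S_D ∪ Γ₁)` is `C^1` on the whole open
cone and vanishes for `‖x‖ ≥ 1`. It is therefore bounded at `x` by the integral of its derivative
along any half-line from `x` inside the cone. Smoothness of `D`, compactness of its closure and
homogeneity of the cone give finitely many frames such that at each point one frame has all its
half-lines in the cone (`IsSmoothSphericalDomain.exists_finite_bases`). Multiplying the `N` ray
estimates and using the grid-lines inequality yields Gagliardo–Nirenberg, and then Sobolev by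
inserting a power of the function. No extension operator is needed, and the vertex plays no special
role.

Boundedness. Testing the equation with a `C^1` version `w` of `(u - k)₊` gives `‖w‖_q² ≤ K ∫ (|c₁| u
+ |c₂|) w`, with `q = 2N/(N-2)`. Since `u ≤ w + k + δ`, Hölder on `{u > k}` produces a term
quadratic in `w`, absorbed when that set is small, and a linear one. What remains bounds the measure
of a higher level set by a power `β = q(1 - 1/s) - 1` of the measure of the lower one
(`measureReal_levelSet_le`). The condition `β > 1` says exactly `1 - 1/s - 2/q > 0`, that is `s >
N/2`; for `s = N/(2-ε)` the gap is `ε/N`. Iteration along levels rising from `d` to `2d`, with `d`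
of order `‖u‖_2 + ‖c₂‖_s`, makes the level set at `2d` null.

Part (b) reduces to the same bound: `f(u)` is dominated by `c₁ u + B` with `c₁ = |c| u^t`, and
subcriticality of `p` together with `u ∈ L^q` puts `c₁` in some `L^s` with `s > N/2`. -/

/-! ### The uniform cone condition for `Σ_D` -/

section Geometry

variable {N : ℕ} {D : Set (Metric.sphere (0 : EuclideanSpace ℝ (Fin N)) 1)}

/-- A function with a strict derivative that is negative in some direction is nonincreasing along
all segments from points near `q` to points of a suitable small ball near `q`. -/
lemma HasStrictFDerivAt.exists_ball_segment_le {E : Type*} [NormedAddCommGroup E]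
    [NormedSpace ℝ E] {f : E → ℝ} {L : E →L[ℝ] ℝ} {q τ : E} (hf : HasStrictFDerivAt f L q)
    (hτ : L τ < 0) {V : Set E} (hV : V ∈ 𝓝 q) :
    ∃ w : E, ∃ r > 0, ∀ y ∈ Metric.ball q r, ∀ w' ∈ Metric.ball w r, ∀ l ∈ Set.Icc (0 : ℝ) 1,
      y + l • (w' - y) ∈ V ∧ f (y + l • (w' - y)) ≤ f y := by
  set c : ℝ := -L τ with hc
  have hc0 : 0 < c := by rw [hc]; linarith
  set T : ℝ := ‖τ‖ + 1 with hT
  have hT0 : 0 < T := by positivity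
  -- Along a segment `f` changes by at most `l * (L (w' - y) + κ * ‖w' - y‖)`. The direction `η • τ`
  -- gains `η * c`; the linearization error along it costs at most `η * c / 4`, and by the choice of
  -- `r` so does the displacement of the two endpoints.
  set κ : ℝ := c / (4 * T) with hκ
  have hκ0 : 0 < κ := by positivity
  have h1 : ∀ᶠ p : E × E in 𝓝 (q, q), ‖f p.1 - f p.2 - L (p.1 - p.2)‖ ≤ κ * ‖p.1 - p.2‖ :=
    hf.isLittleO.bound hκ0
  rw [nhds_prod_eq, (Metric.nhds_basis_ball.prod_self).eventually_iff] at h1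
  obtain ⟨R1, hR1, h1⟩ := h1
  obtain ⟨R2, hR2, h2⟩ := Metric.mem_nhds_iff.1 hV
  set R : ℝ := min R1 R2
  have hR : 0 < R := lt_min hR1 hR2
  set η : ℝ := R / (4 * T) with hη
  have hη0 : 0 < η := by positivity
  set r : ℝ := min (R / 4) (η * c / (8 * (‖L‖ + κ + 1))) with hr
  have hr0 : 0 < r := by positivity
  have hηT : η * ‖τ‖ ≤ R / 4 := by
    have : η * T = R / 4 := by rw [hη]; field_simp
    nlinarith
  have hκT : κ * ‖τ‖ ≤ c / 4 := by
    have : κ * T = c / 4 := by rw [hκ]; field_simp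
    nlinarith
  have hr1 : r ≤ R / 4 := min_le_left _ _
  have hr2 : r * (‖L‖ + κ + 1) ≤ η * c / 8 := by
    have h := min_le_right (R / 4) (η * c / (8 * (‖L‖ + κ + 1)))
    rw [← hr] at h
    have h3 : 0 < ‖L‖ + κ + 1 := by positivity
    calc r * (‖L‖ + κ + 1) ≤ (η * c / (8 * (‖L‖ + κ + 1))) * (‖L‖ + κ + 1) := by gcongr
      _ = η * c / 8 := by field_simp
  refine ⟨q + η • τ, r, hr0, fun y hy w' hw' l hl => ?_⟩
  rw [mem_ball_iff_norm] at hy hw'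
  set e : E := (w' - (q + η • τ)) - (y - q) with he
  have he' : w' - y = η • τ + e := by rw [he]; abel
  have hen : ‖e‖ ≤ 2 * r := (norm_sub_le _ _).trans (by linarith)
  have hyR : y ∈ Metric.ball q R := by rw [mem_ball_iff_norm]; linarith
  have hwR : w' ∈ Metric.ball q R := by
    rw [mem_ball_iff_norm]
    have h3 : w' - q = (w' - (q + η • τ)) + η • τ := by abel
    have h4 : ‖η • τ‖ = η * ‖τ‖ := by rw [norm_smul, Real.norm_of_nonneg hη0.le]
    have h5 := norm_add_le (w' - (q + η • τ)) (η • τ)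
    rw [← h3, h4] at h5
    linarith
  have hzR : y + l • (w' - y) ∈ Metric.ball q R :=
    (convex_ball q R).add_smul_sub_mem hyR hwR hl
  refine ⟨h2 (Metric.ball_subset_ball (min_le_right _ _) hzR), ?_⟩
  have h3 := @h1 (y + l • (w' - y), y) ⟨Metric.ball_subset_ball (min_le_left _ _) hzR,
    Metric.ball_subset_ball (min_le_left _ _) hyR⟩
  simp only [add_sub_cancel_left, norm_smul, Real.norm_of_nonneg hl.1, map_smul,
    smul_eq_mul] at h3
  have h4 := (abs_le.1 h3).2
  have h5 : L (w' - y) = -(η * c) + L e := by rw [he', map_add, map_smul, smul_eq_mul, hc]; ring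
  have h6 : L e ≤ ‖L‖ * (2 * r) :=
    (le_abs_self _).trans ((L.le_opNorm e).trans (by gcongr))
  have h7 : ‖w' - y‖ ≤ η * ‖τ‖ + 2 * r := by
    rw [he']
    refine (norm_add_le _ _).trans ?_
    rw [norm_smul, Real.norm_of_nonneg hη0.le]
    linarith
  have h8 : κ * ‖w' - y‖ ≤ η * (c / 4) + 2 * r * κ := by
    calc κ * ‖w' - y‖ ≤ κ * (η * ‖τ‖ + 2 * r) := by gcongr
      _ = η * (κ * ‖τ‖) + 2 * r * κ := by ring
      _ ≤ _ := by gcongr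
  have h9 : L (w' - y) + κ * ‖w' - y‖ ≤ 0 := by
    have : 0 < η * c := by positivity
    nlinarith
  nlinarith [mul_nonpos_of_nonneg_of_nonpos hl.1 h9]

lemma exists_isOpen_mem_sphericalCone_iff (hD : IsOpen D) :
    ∃ V : Set (EuclideanSpace ℝ (Fin N)), IsOpen V ∧
      (∀ q : Metric.sphere (0 : EuclideanSpace ℝ (Fin N)) 1,
        q ∈ D ↔ (q : EuclideanSpace ℝ (Fin N)) ∈ V) ∧
      ∀ x, x ∈ sphericalCone D ↔ x ≠ 0 ∧ ‖x‖⁻¹ • x ∈ V := by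
  obtain ⟨V, hV, rfl⟩ := isOpen_induced_iff.1 hD
  refine ⟨V, hV, fun q => Iff.rfl, fun x => ⟨?_, fun ⟨hx, hxV⟩ => ?_⟩⟩
  · rintro ⟨q, hq, s, hs, rfl⟩
    have hq1 : ‖(q : EuclideanSpace ℝ (Fin N))‖ = 1 := by simp
    refine ⟨smul_ne_zero hs.ne' (by rw [← norm_ne_zero_iff, hq1]; exact one_ne_zero), ?_⟩
    rw [norm_smul, hq1, Real.norm_of_nonneg hs.le, smul_smul, mul_one, inv_mul_cancel₀ hs.ne',
      one_smul]
    exact hq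
  · have hx0 : 0 < ‖x‖ := norm_pos_iff.2 hx
    refine ⟨⟨‖x‖⁻¹ • x, by simp [norm_smul, hx0.ne']⟩, hxV, ‖x‖, hx0, ?_⟩
    simp [smul_smul, hx0.ne']

lemma continuousOn_inv_norm_smul {E : Type*} [NormedAddCommGroup E] [NormedSpace ℝ E] :
    ContinuousOn (fun x : E => ‖x‖⁻¹ • x) {0}ᶜ :=
  (continuousOn_id.norm.inv₀ fun _ hx => norm_ne_zero_iff.2 hx).smul continuousOn_id

lemma isOpen_sphericalCone (hD : IsOpen D) : IsOpen (sphericalCone D) := by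
  obtain ⟨V, hV, -, h⟩ := exists_isOpen_mem_sphericalCone_iff hD
  have : sphericalCone D = {0}ᶜ ∩ (fun x => ‖x‖⁻¹ • x) ⁻¹' V := by
    ext x; rw [h]; rfl
  rw [this]
  exact continuousOn_inv_norm_smul.isOpen_inter_preimage isOpen_compl_singleton hV

lemma smul_mem_sphericalCone {x : EuclideanSpace ℝ (Fin N)} (hx : x ∈ sphericalCone D) {t : ℝ}
    (ht : 0 < t) : t • x ∈ sphericalCone D := by
  obtain ⟨q, hq, s, hs, rfl⟩ := hx
  exact ⟨q, hq, t * s, mul_pos ht hs, by rw [smul_smul]⟩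

lemma ne_zero_of_mem_sphericalCone {x : EuclideanSpace ℝ (Fin N)} (hx : x ∈ sphericalCone D) :
    x ≠ 0 := by
  obtain ⟨q, hq, s, hs, rfl⟩ := hx
  have hq1 : ‖(q : EuclideanSpace ℝ (Fin N))‖ = 1 := by simp
  exact smul_ne_zero hs.ne' (by rw [← norm_ne_zero_iff, hq1]; exact one_ne_zero)

lemma coe_mem_sphericalCone_iff {q : Metric.sphere (0 : EuclideanSpace ℝ (Fin N)) 1} :
    (q : EuclideanSpace ℝ (Fin N)) ∈ sphericalCone D ↔ q ∈ D := by
  refine ⟨?_, fun h => ⟨q, h, 1, one_pos, by simp⟩⟩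
  rintro ⟨q', hq', s, hs, h⟩
  have h1 : ‖(q : EuclideanSpace ℝ (Fin N))‖ = s * 1 := by
    rw [h, norm_smul, Real.norm_of_nonneg hs.le]; simp
  have hs1 : s = 1 := by simpa using h1.symm
  rw [hs1, one_smul] at h
  rwa [Subtype.ext h]

lemma sphericalSector_eq : sphericalSector D = sphericalCone D ∩ Metric.ball 0 1 := by
  ext x
  constructor
  · rintro ⟨q, hq, s, hs, hs1, rfl⟩
    refine ⟨⟨q, hq, s, hs, rfl⟩, ?_⟩
    rw [mem_ball_zero_iff, norm_smul, Real.norm_of_nonneg hs.le]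
    simpa using hs1
  · rintro ⟨⟨q, hq, s, hs, rfl⟩, h⟩
    refine ⟨q, hq, s, hs, ?_, rfl⟩
    rw [mem_ball_zero_iff, norm_smul, Real.norm_of_nonneg hs.le] at h
    simpa using h

lemma isOpen_sphericalSector (hD : IsOpen D) : IsOpen (sphericalSector D) := by
  rw [sphericalSector_eq]
  exact (isOpen_sphericalCone hD).inter Metric.isOpen_ball

/-- Passing from segments to half-lines by homogeneity. -/
lemma add_smul_mem_sphericalCone_of_segment {x w : EuclideanSpace ℝ (Fin N)} (hx : x ≠ 0)
    (h : ∀ l ∈ Set.Ico (0 : ℝ) 1, ‖x‖⁻¹ • x + l • (w - ‖x‖⁻¹ • x) ∈ sphericalCone D)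
    {t : ℝ} (ht : 0 ≤ t) : x + t • w ∈ sphericalCone D := by
  have hx0 : 0 < ‖x‖ := norm_pos_iff.2 hx
  have hs : 0 < ‖x‖ + t := by positivity
  -- `x + t • w` is `‖x‖ + t` times the point with parameter `t / (‖x‖ + t) < 1` on the segment from
  -- `‖x‖⁻¹ • x` to `w`.
  have h1 := smul_mem_sphericalCone (h (t / (‖x‖ + t))
    ⟨by positivity, by rw [div_lt_one hs]; linarith⟩) hs
  convert h1 using 1
  have h2 : (‖x‖ + t) * (t / (‖x‖ + t)) = t := by field_simp
  rw [smul_add, smul_smul, smul_smul, h2, smul_sub, smul_smul, add_mul, add_smul,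
    mul_inv_cancel₀ hx0.ne', one_smul]
  abel

/-- The radial projection fixes tangent directions to first order at a unit vector. Hence `ρ (‖x‖⁻¹
• x)`, which describes the cone rather than just `D`, inherits the nonzero tangential derivative of
`ρ`. -/
lemma hasStrictFDerivAt_inv_norm_smul {E : Type*} [NormedAddCommGroup E] [InnerProductSpace ℝ E]
    {q : E} (hq : ‖q‖ = 1) : ∃ L : E →L[ℝ] E,
      HasStrictFDerivAt (fun x : E => ‖x‖⁻¹ • x) L q ∧ ∀ τ, inner ℝ q τ = 0 → L τ = τ := by
  have h1 : HasStrictFDerivAt (fun x : E => ‖x‖ ^ 2) (2 • innerSL ℝ q) q :=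
    hasStrictFDerivAt_norm_sq q
  have hq2 : ‖q‖ ^ 2 ≠ 0 := by rw [hq]; norm_num
  have h2 := (Real.hasStrictDerivAt_sqrt hq2).comp_hasStrictFDerivAt q h1
  have h2' : √(‖q‖ ^ 2) ≠ 0 := by rw [hq]; norm_num
  have h3 := (hasStrictDerivAt_inv h2').comp_hasStrictFDerivAt q h2
  have h4 := h3.fun_smul (hasStrictFDerivAt_id q)
  refine ⟨_, h4.congr_of_eventuallyEq (Eventually.of_forall fun x => ?_), ?_⟩
  · simp [Real.sqrt_sq (norm_nonneg x)]
  · intro τ hτ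
    simp [hτ, hq]

/-- The cone condition, locally uniformly in the direction: near every `q ∈ closure D` the cone
`Σ_D` contains all half-lines whose direction lies in a fixed ball. -/
lemma IsSmoothSphericalDomain.exists_ball_add_smul_mem (hD : IsSmoothSphericalDomain D)
    {q : Metric.sphere (0 : EuclideanSpace ℝ (Fin N)) 1} (hq : q ∈ closure D) :
    ∃ w : EuclideanSpace ℝ (Fin N), ∃ r > 0, ∀ x ∈ sphericalCone D,
      ‖x‖⁻¹ • x ∈ Metric.ball (q : EuclideanSpace ℝ (Fin N)) r →
      ∀ w' ∈ Metric.ball w r, ∀ t : ℝ, 0 ≤ t → x + t • w' ∈ sphericalCone D := by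
  have hq1 : ‖(q : EuclideanSpace ℝ (Fin N))‖ = 1 := by simp
  have hq0 : (q : EuclideanSpace ℝ (Fin N)) ≠ 0 := by rw [← norm_ne_zero_iff, hq1]; norm_num
  by_cases hqD : q ∈ D
  · obtain ⟨r, hr, h⟩ := Metric.isOpen_iff.1 (isOpen_sphericalCone hD.isOpen) q
      (coe_mem_sphericalCone_iff.2 hqD)
    refine ⟨q, r, hr, fun x hx hxr w' hw' t ht => ?_⟩
    refine add_smul_mem_sphericalCone_of_segment (ne_zero_of_mem_sphericalCone hx)
      (fun l hl => h ?_) ht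
    exact (convex_ball _ r).add_smul_sub_mem hxr hw' ⟨hl.1, hl.2.le⟩
  · have hqf : q ∈ frontier D := by rw [hD.isOpen.frontier_eq]; exact ⟨hq, hqD⟩
    obtain ⟨U, ρ, hU, hqU, hρ, ⟨τ, hτ, hτ'⟩, hUD⟩ := hD.smooth_boundary q hqf
    obtain ⟨L, hL, hLτ⟩ := hasStrictFDerivAt_inv_norm_smul hq1
    have hqq : ‖(q : EuclideanSpace ℝ (Fin N))‖⁻¹ • (q : EuclideanSpace ℝ (Fin N)) = q := by simp
    have hρq : HasStrictFDerivAt ρ (fderiv ℝ ρ q) q :=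
      (hρ.contDiffAt (hU.mem_nhds hqU)).hasStrictFDerivAt (by simp)
    have hcomp : HasStrictFDerivAt (fun x => ρ (‖x‖⁻¹ • x)) ((fderiv ℝ ρ q).comp L)
        (q : EuclideanSpace ℝ (Fin N)) := by
      refine HasStrictFDerivAt.comp (g := ρ) (q : EuclideanSpace ℝ (Fin N)) ?_ hL
      rwa [hqq]
    obtain ⟨τ', hτ'1⟩ : ∃ τ', ((fderiv ℝ ρ q).comp L) τ' < 0 := by
      rcases lt_or_gt_of_ne hτ' with h | h
      · exact ⟨τ, by simpa [hLτ τ hτ] using h⟩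
      · exact ⟨-τ, by simpa [hLτ τ hτ] using h⟩
    have hV : {0}ᶜ ∩ (fun x => ‖x‖⁻¹ • x) ⁻¹' U ∈ 𝓝 (q : EuclideanSpace ℝ (Fin N)) := by
      refine (continuousOn_inv_norm_smul.isOpen_inter_preimage isOpen_compl_singleton
        hU).mem_nhds ⟨hq0, ?_⟩
      rw [Set.mem_preimage, hqq]
      exact hqU
    obtain ⟨w, r, hr, h⟩ := hcomp.exists_ball_segment_le hτ'1 hV
    obtain ⟨V, -, hVD, hVC⟩ := exists_isOpen_mem_sphericalCone_iff hD.isOpen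
    have key : ∀ z ∈ {0}ᶜ ∩ (fun x : EuclideanSpace ℝ (Fin N) => ‖x‖⁻¹ • x) ⁻¹' U,
        z ∈ sphericalCone D ↔ ρ (‖z‖⁻¹ • z) < 0 := by
      rintro z ⟨hz0, hzU⟩
      have hz0' : ‖z‖ ≠ 0 := norm_ne_zero_iff.2 hz0
      have h1 := hUD ⟨‖z‖⁻¹ • z, by simp [norm_smul, hz0']⟩ hzU
      rw [hVD] at h1
      rw [← h1, hVC]
      exact ⟨fun h => h.2, fun h => ⟨hz0, h⟩⟩
    refine ⟨w, r, hr, fun x hx hxr w' hw' t ht => ?_⟩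
    refine add_smul_mem_sphericalCone_of_segment (ne_zero_of_mem_sphericalCone hx)
      (fun l hl => ?_) ht
    have hx0 : 0 < ‖x‖ := norm_pos_iff.2 (ne_zero_of_mem_sphericalCone hx)
    obtain ⟨hl1, hl2⟩ := h _ hxr _ hw' l ⟨hl.1, hl.2.le⟩
    obtain ⟨h01, -⟩ := h _ hxr _ hw' 0 ⟨le_rfl, zero_le_one⟩
    rw [zero_smul, add_zero] at h01
    rw [key _ hl1]
    exact hl2.trans_lt ((key _ h01).1 (smul_mem_sphericalCone hx (inv_pos.2 hx0)))

/-- A subspace with nonempty interior is the whole space, so a nonempty open set spans and a basis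
can be extracted from it. This turns a ball of admissible directions into a frame. -/
lemma exists_basis_mem_of_isOpen {E : Type*} [NormedAddCommGroup E] [NormedSpace ℝ E]
    [FiniteDimensional ℝ E] {n : ℕ} (hn : Module.finrank ℝ E = n) {U : Set E} (hU : IsOpen U)
    (hne : U.Nonempty) : ∃ b : Module.Basis (Fin n) ℝ E, ∀ i, b i ∈ U := by
  have hspan : (⊤ : Submodule ℝ E) ≤ Submodule.span ℝ U := by
    rw [Submodule.eq_top_of_nonempty_interior' (Submodule.span ℝ U)]
    exact hne.mono (interior_maximal Submodule.subset_span hU)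
  let b := Module.Basis.ofSpan hspan
  have : Fintype _ := FiniteDimensional.fintypeBasisIndex b
  let e := Fintype.equivFinOfCardEq ((Module.finrank_eq_card_basis b).symm.trans hn)
  refine ⟨b.reindex e, fun i => ?_⟩
  rw [Module.Basis.reindex_apply]
  exact Module.Basis.ofSpan_subset hspan ⟨_, rfl⟩

/-- The uniform cone condition for `Σ_D`: finitely many frames suffice. -/
lemma IsSmoothSphericalDomain.exists_finite_bases (hD : IsSmoothSphericalDomain D) :
    ∃ B : Finset (Module.Basis (Fin N) ℝ (EuclideanSpace ℝ (Fin N))),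
      ∀ x ∈ sphericalCone D, ∃ b ∈ B, ∀ i, ∀ t : ℝ, 0 ≤ t → x + t • b i ∈ sphericalCone D := by
  classical
  have : Nonempty (Module.Basis (Fin N) ℝ (EuclideanSpace ℝ (Fin N))) :=
    ⟨(EuclideanSpace.basisFun (Fin N) ℝ).toBasis⟩
  have hex : ∀ q ∈ closure D, ∃ b : Module.Basis (Fin N) ℝ (EuclideanSpace ℝ (Fin N)), ∃ r > 0,
      ∀ x ∈ sphericalCone D, ‖x‖⁻¹ • x ∈ Metric.ball (q : EuclideanSpace ℝ (Fin N)) r →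
      ∀ i, ∀ t : ℝ, 0 ≤ t → x + t • b i ∈ sphericalCone D := by
    intro q hq
    obtain ⟨w, r, hr, h⟩ := hD.exists_ball_add_smul_mem hq
    obtain ⟨b, hb⟩ := exists_basis_mem_of_isOpen (E := EuclideanSpace ℝ (Fin N)) (n := N)
      (by simp) (Metric.isOpen_ball (x := w) (ε := r)) ⟨w, Metric.mem_ball_self hr⟩
    exact ⟨b, r, hr, fun x hx hxr i t ht => h x hx hxr _ (hb i) t ht⟩
  choose! b r hr h using hex
  obtain ⟨T, hT, hcov⟩ := (isClosed_closure (s := D)).isCompact.elim_nhds_subcover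
    (fun q => Metric.ball q (r q)) (fun q hq => Metric.ball_mem_nhds _ (hr q hq))
  refine ⟨T.image b, fun x hx => ?_⟩
  obtain ⟨p, hp, s, hs, hxs⟩ := hx
  obtain ⟨q, hqT, hq⟩ := Set.mem_iUnion₂.1 (hcov (subset_closure hp))
  refine ⟨b q, Finset.mem_image_of_mem _ hqT, h q (hT q hqT) x ⟨p, hp, s, hs, hxs⟩ ?_⟩
  have : ‖x‖⁻¹ • x = p := by
    have hp1 : ‖(p : EuclideanSpace ℝ (Fin N))‖ = 1 := by simp
    rw [hxs, norm_smul, hp1, Real.norm_of_nonneg hs.le, smul_smul, mul_one,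
      inv_mul_cancel₀ hs.ne', one_smul]
  rw [this]
  exact hq

end Geometry

/-! ### Gagliardo–Nirenberg and Sobolev inequalities from rays -/

section Sobolev

/-- The grid-lines inequality along the directions of an arbitrary basis. -/
lemma exists_lintegral_prod_lintegral_le {E : Type*} [NormedAddCommGroup E] [NormedSpace ℝ E]
    [MeasurableSpace E] [BorelSpace E] [FiniteDimensional ℝ E] (μ : Measure E)
    [μ.IsAddHaarMeasure] {n : ℕ} {p : ℝ} (hp : Real.HolderConjugate n p)
    (b : Module.Basis (Fin n) ℝ E) :
    ∃ C : ℝ≥0, ∀ G : E → ℝ≥0∞, Measurable G →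
      ∫⁻ x, ∏ i, (∫⁻ t : ℝ, G (x + t • b i)) ^ (1 / ((n : ℝ) - 1)) ∂μ
        ≤ C * (∫⁻ x, G x ∂μ) ^ p := by
  classical
  let L : (Fin n → ℝ) ≃L[ℝ] E := b.equivFun.symm.toContinuousLinearEquiv
  let ν : Measure E := Measure.map L volume
  -- By uniqueness of Haar measure, `μ` and the image `ν` of the product measure are multiples of
  -- each other. One factor enters the left side linearly, the other enters the right side to the
  -- power `p`.
  have h1 : μ = μ.addHaarScalarFactor ν • ν := Measure.isAddLeftInvariant_eq_smul μ ν
  have h2 : ν = ν.addHaarScalarFactor μ • μ := Measure.isAddLeftInvariant_eq_smul ν μ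
  have hp0 : 0 ≤ p := hp.symm.nonneg
  refine ⟨μ.addHaarScalarFactor ν * (ν.addHaarScalarFactor μ) ^ p, fun G hG => ?_⟩
  have hmap : ∀ f : E → ℝ≥0∞, ∫⁻ x, f x ∂ν = ∫⁻ a : Fin n → ℝ, f (L a) := fun f =>
    lintegral_map_equiv f L.toHomeomorph.toMeasurableEquiv
  have hL : ∀ (a : Fin n → ℝ) (i : Fin n) (s : ℝ),
      L (Function.update a i s) = L a + (s - a i) • b i := by
    intro a i s
    have hu : Function.update a i s = a + (s - a i) • Pi.single i (1 : ℝ) := by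
      ext j
      by_cases hj : j = i
      · subst hj; simp
      · simp [hj]
    have hb : L (Pi.single i 1) = b i := by
      simp [L]
    rw [hu, map_add, map_smul, hb]
  have hline : ∀ (a : Fin n → ℝ) (i : Fin n),
      ∫⁻ t : ℝ, G (L a + t • b i) = ∫⁻ s : ℝ, (G ∘ L) (Function.update a i s) := by
    intro a i
    simp only [Function.comp_apply, hL]
    exact (lintegral_sub_right_eq_self (fun t => G (L a + t • b i)) (a i)).symm
  have hGL : Measurable (G ∘ L) := hG.comp L.continuous.measurable
  have hp' : Real.HolderConjugate (Fintype.card (Fin n) : ℝ) p := by simpa using hp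
  have key := lintegral_prod_lintegral_pow_le (fun _ : Fin n => (volume : Measure ℝ)) hp' hGL
  rw [Fintype.card_fin] at key
  have hνint : ∫⁻ x, G x ∂ν = ν.addHaarScalarFactor μ * ∫⁻ x, G x ∂μ := by
    conv_lhs => rw [h2]
    rw [lintegral_smul_measure]; rfl
  calc ∫⁻ x, ∏ i, (∫⁻ t : ℝ, G (x + t • b i)) ^ (1 / ((n : ℝ) - 1)) ∂μ
      = μ.addHaarScalarFactor ν *
          ∫⁻ x, ∏ i, (∫⁻ t : ℝ, G (x + t • b i)) ^ (1 / ((n : ℝ) - 1)) ∂ν := by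
        conv_lhs => rw [h1]
        rw [lintegral_smul_measure]; rfl
    _ ≤ μ.addHaarScalarFactor ν * (∫⁻ x, G x ∂ν) ^ p := by
        gcongr
        rw [hmap, hmap]
        simp only [hline]
        exact key
    _ = _ := by
        rw [hνint, ENNReal.mul_rpow_of_nonneg _ _ hp0, ← mul_assoc, ENNReal.coe_mul,
          ENNReal.coe_rpow_of_nonneg _ hp0]

/-- A `C¹` function vanishing far out is bounded by the integral of its derivative along any
half-line. -/
lemma enorm_le_lintegral_of_ray {E : Type*} [NormedAddCommGroup E] [NormedSpace ℝ E]
    {Ω : Set E} (hΩ : IsOpen Ω) {F : E → ℝ} (hF : ContDiffOn ℝ 1 F Ω)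
    (hF0 : ∀ x ∈ Ω, 1 ≤ ‖x‖ → F x = 0) {x w : E} (hw : w ≠ 0)
    (hray : ∀ t : ℝ, 0 ≤ t → x + t • w ∈ Ω) :
    ‖F x‖ₑ ≤ ∫⁻ t : ℝ, ‖w‖ₑ * Ω.indicator (fun y => ‖fderiv ℝ F y‖ₑ) (x + t • w) := by
  have hw0 : 0 < ‖w‖ := norm_pos_iff.2 hw
  -- Long enough that `‖x + T • w‖ ≥ T * ‖w‖ - ‖x‖ = 1`, where `F` vanishes.
  set T : ℝ := (‖x‖ + 1) / ‖w‖ with hT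
  have hT0 : 0 ≤ T := by positivity
  have hTw : T * ‖w‖ = ‖x‖ + 1 := by rw [hT]; field_simp
  have hend : F (x + T • w) = 0 := by
    refine hF0 _ (hray T hT0) ?_
    have h1 : ‖T • w‖ = ‖x‖ + 1 := by rw [norm_smul, Real.norm_of_nonneg hT0, hTw]
    have h2 := norm_sub_le (x + T • w) x
    rw [add_sub_cancel_left, h1] at h2
    linarith
  have hline : ∀ t : ℝ, HasDerivAt (fun t : ℝ => x + t • w) w t := fun t => by
    simpa using ((hasDerivAt_id t).smul_const w).const_add x
  have hcd : ContDiffOn ℝ 1 (fun t : ℝ => F (x + t • w)) (Set.Icc 0 T) := by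
    refine hF.comp (g := F) (f := fun t : ℝ => x + t • w) ?_ fun t ht => hray t ht.1
    exact (contDiff_const.add (contDiff_id.smul contDiff_const)).contDiffOn
  have h1 := enorm_sub_le_lintegral_deriv_of_contDiffOn_Icc hcd hT0
  simp only [zero_smul, add_zero, hend, zero_sub, enorm_neg] at h1
  refine h1.trans ?_
  refine (setLIntegral_mono' measurableSet_Icc fun t ht => ?_).trans
    (setLIntegral_le_lintegral _ _)
  have hd : HasDerivAt (fun t : ℝ => F (x + t • w)) (fderiv ℝ F (x + t • w) w) t :=
    HasFDerivAt.comp_hasDerivAt t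
      ((hF.differentiableOn one_ne_zero).differentiableAt
        (hΩ.mem_nhds (hray t ht.1))).hasFDerivAt (hline t)
  rw [hd.deriv, Set.indicator_of_mem (hray t ht.1), mul_comm]
  exact ContinuousLinearMap.le_opENorm _ _

/-- The Gagliardo-Nirenberg inequality in an open set that contains, with each of its points, the
half-lines spanned by one of finitely many frames. -/
lemma exists_lintegral_rpow_le_of_bases {E : Type*} [NormedAddCommGroup E] [NormedSpace ℝ E]
    [MeasurableSpace E] [BorelSpace E] [FiniteDimensional ℝ E] (μ : Measure E)
    [μ.IsAddHaarMeasure] {n : ℕ} (hn : 2 ≤ n) {Ω : Set E} (hΩ : IsOpen Ω)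
    {B : Finset (Module.Basis (Fin n) ℝ E)}
    (hB : ∀ x ∈ Ω, ∃ b ∈ B, ∀ i, ∀ t : ℝ, 0 ≤ t → x + t • b i ∈ Ω) :
    ∃ C : ℝ≥0, ∀ F : E → ℝ, ContDiffOn ℝ 1 F Ω → (∀ x ∈ Ω, 1 ≤ ‖x‖ → F x = 0) →
      ∫⁻ x in Ω, ‖F x‖ₑ ^ ((n : ℝ) / (n - 1)) ∂μ ≤
        C * (∫⁻ x in Ω, ‖fderiv ℝ F x‖ₑ ∂μ) ^ ((n : ℝ) / (n - 1)) := by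
  have hn2 : (2 : ℝ) ≤ n := by exact_mod_cast hn
  have hp : Real.HolderConjugate n ((n : ℝ) / (n - 1)) :=
    (Real.holderConjugate_iff_eq_conjExponent (by linarith)).2 rfl
  set p : ℝ := (n : ℝ) / (n - 1) with hpdef
  have hp0 : 0 ≤ p := hp.symm.nonneg
  choose C hC using fun b : Module.Basis (Fin n) ℝ E => exists_lintegral_prod_lintegral_le μ hp b
  let K : Module.Basis (Fin n) ℝ E → ℝ≥0 := fun b => ∑ i, ‖b i‖₊
  refine ⟨∑ b ∈ B, C b * K b ^ p, fun F hF hF0 => ?_⟩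
  let G : E → ℝ≥0∞ := Ω.indicator (fun y => ‖fderiv ℝ F y‖ₑ)
  have hG : Measurable G := (measurable_fderiv ℝ F).enorm.indicator hΩ.measurableSet
  -- The admissible frame depends on `x`; summing over all of `B` avoids choosing it measurably. The
  -- common factor `K b` replaces the different lengths `‖b i‖`.
  let P : Module.Basis (Fin n) ℝ E → E → ℝ≥0∞ := fun b x =>
    ∏ i, (∫⁻ t : ℝ, (K b : ℝ≥0∞) * G (x + t • b i)) ^ (1 / ((n : ℝ) - 1))
  have hPmeas : ∀ b, Measurable (P b) := by
    intro b
    refine Finset.measurable_prod _ fun i _ => Measurable.pow_const ?_ _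
    refine Measurable.lintegral_prod_right' (f := fun z : E × ℝ => (K b : ℝ≥0∞) * G (z.1 + z.2 • b i)) ?_
    exact (hG.comp (by fun_prop)).const_mul _
  have hpt : ∀ x ∈ Ω, ‖F x‖ₑ ^ p ≤ ∑ b ∈ B, P b x := by
    intro x hx
    obtain ⟨b, hbB, hb⟩ := hB x hx
    refine le_trans ?_ (Finset.single_le_sum (fun _ _ => zero_le) hbB)
    have h1 : ∀ i, ‖F x‖ₑ ≤ ∫⁻ t : ℝ, (K b : ℝ≥0∞) * G (x + t • b i) := by
      intro i
      refine (enorm_le_lintegral_of_ray hΩ hF hF0 (b.ne_zero i) (hb i)).trans ?_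
      refine lintegral_mono fun t => ?_
      gcongr
      refine ENNReal.coe_le_coe.2 ?_
      exact Finset.single_le_sum (f := fun i => ‖b i‖₊) (fun _ _ => zero_le) (Finset.mem_univ i)
    have h2 : ‖F x‖ₑ ^ p = ∏ _i : Fin n, ‖F x‖ₑ ^ (1 / ((n : ℝ) - 1)) := by
      rw [Finset.prod_const, Finset.card_univ, Fintype.card_fin, ← ENNReal.rpow_natCast,
        ← ENNReal.rpow_mul]
      congr 1
      rw [hpdef]; ring
    rw [h2]
    refine Finset.prod_le_prod' fun i _ => ENNReal.rpow_le_rpow (h1 i) ?_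
    exact one_div_nonneg.2 (by linarith)
  have hGint : ∫⁻ x, G x ∂μ = ∫⁻ x in Ω, ‖fderiv ℝ F x‖ₑ ∂μ :=
    lintegral_indicator hΩ.measurableSet _
  calc ∫⁻ x in Ω, ‖F x‖ₑ ^ p ∂μ ≤ ∫⁻ x in Ω, ∑ b ∈ B, P b x ∂μ :=
        setLIntegral_mono' hΩ.measurableSet hpt
    _ ≤ ∫⁻ x, ∑ b ∈ B, P b x ∂μ := setLIntegral_le_lintegral _ _
    _ = ∑ b ∈ B, ∫⁻ x, P b x ∂μ := lintegral_finsetSum _ fun b _ => hPmeas b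
    _ ≤ ∑ b ∈ B, (C b : ℝ≥0∞) * (∫⁻ x, (K b : ℝ≥0∞) * G x ∂μ) ^ p :=
        Finset.sum_le_sum fun b _ => hC b (fun y => (K b : ℝ≥0∞) * G y) (hG.const_mul _)
    _ = _ := by
        push_cast
        rw [Finset.sum_mul]
        refine Finset.sum_congr rfl fun b _ => ?_
        rw [lintegral_const_mul _ hG, hGint, ENNReal.mul_rpow_of_nonneg _ _ hp0, ← mul_assoc,
          ENNReal.coe_rpow_of_nonneg _ hp0]

/-- The Sobolev inequality `‖F‖_{2n/(n-2)} ≤ C ‖DF‖_2` in such sets. -/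
lemma exists_sobolev_of_bases {E : Type*} [NormedAddCommGroup E] [NormedSpace ℝ E]
    [MeasurableSpace E] [BorelSpace E] [FiniteDimensional ℝ E] (μ : Measure E)
    [μ.IsAddHaarMeasure] {n : ℕ} (hn : 3 ≤ n) {Ω : Set E} (hΩ : IsOpen Ω)
    {B : Finset (Module.Basis (Fin n) ℝ E)}
    (hB : ∀ x ∈ Ω, ∃ b ∈ B, ∀ i, ∀ t : ℝ, 0 ≤ t → x + t • b i ∈ Ω) :
    ∃ C : ℝ≥0, ∀ F : E → ℝ, ContDiffOn ℝ 1 F Ω → (∀ x ∈ Ω, 1 ≤ ‖x‖ → F x = 0) →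
      (∃ K : ℝ≥0, ∀ x ∈ Ω, ‖F x‖ₑ ≤ K) →
      (∫⁻ x in Ω, ‖F x‖ₑ ^ (2 * (n : ℝ) / (n - 2)) ∂μ) ^ (1 / (2 * (n : ℝ) / (n - 2))) ≤
        C * (∫⁻ x in Ω, ‖fderiv ℝ F x‖ₑ ^ (2 : ℝ) ∂μ) ^ (1 / (2 : ℝ)) := by
  obtain ⟨C, hC⟩ := exists_lintegral_rpow_le_of_bases μ (by lia : 2 ≤ n) hΩ hB
  have hn3 : (3 : ℝ) ≤ n := by exact_mod_cast hn
  have hm1 : (0 : ℝ) < n - 1 := by linarith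
  have hm2 : (0 : ℝ) < n - 2 := by linarith
  set p : ℝ := (n : ℝ) / (n - 1) with hp
  set q : ℝ := 2 * (n : ℝ) / (n - 2) with hq
  -- Gagliardo–Nirenberg is applied to `|F| ^ γ`. Since `γ * p = q` and `(γ - 1) * 2 = q`,
  -- Cauchy–Schwarz reproduces the same integral `A` on the right, to the smaller power `p / 2`.
  set γ : ℝ := 2 * ((n : ℝ) - 1) / (n - 2) with hγ
  have hp0 : 0 < p := by positivity
  have hq0 : 0 < q := by positivity
  have hγ1 : 1 < γ := by rw [hγ, lt_div_iff₀ hm2]; linarith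
  have hγp : γ * p = q := by rw [hγ, hp, hq]; field_simp
  have hγ2 : (γ - 1) * 2 = q := by rw [hγ, hq]; field_simp; ring
  have hpq : 1 - 1 / 2 * p = p / q := by rw [hp, hq]; field_simp; ring
  have hpq0 : 0 < p / q := by positivity
  let γ' : ℝ≥0 := γ.toNNReal
  refine ⟨(C * γ' ^ p) ^ (1 / p), fun F hF hF0 ⟨K, hK⟩ => ?_⟩
  set A := ∫⁻ x in Ω, ‖F x‖ₑ ^ q ∂μ with hA
  set Bd := ∫⁻ x in Ω, ‖fderiv ℝ F x‖ₑ ^ (2 : ℝ) ∂μ with hBd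
  -- Finiteness, from boundedness of `F` and its vanishing outside the unit ball, allows the later
  -- division by `A ^ (p / 2)`.
  have hAtop : A ≠ ⊤ := by
    have h1 : A ≤ ∫⁻ x, (Metric.ball (0 : E) 1).indicator (fun _ => (K : ℝ≥0∞) ^ q) x ∂μ := by
      refine (setLIntegral_mono' hΩ.measurableSet fun x hx => ?_).trans
        (setLIntegral_le_lintegral _ _)
      by_cases hx1 : x ∈ Metric.ball (0 : E) 1
      · rw [Set.indicator_of_mem hx1]
        exact ENNReal.rpow_le_rpow (hK x hx) hq0.le
      · rw [hF0 x hx (by simpa using hx1)]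
        simp [hq0]
    refine ne_top_of_le_ne_top ?_ h1
    rw [lintegral_indicator_const measurableSet_ball]
    exact ENNReal.mul_ne_top (ENNReal.rpow_ne_top_of_nonneg hq0.le ENNReal.coe_ne_top)
      measure_ball_lt_top.ne
  have hdiff : ∀ x ∈ Ω, DifferentiableAt ℝ F x := fun x hx =>
    (hF.differentiableOn one_ne_zero).differentiableAt (hΩ.mem_nhds hx)
  have hH : ContDiffOn ℝ 1 (fun x => ‖F x‖ ^ γ) Ω :=
    (contDiff_norm_rpow (E := ℝ) hγ1).comp_contDiffOn hF
  have hH0 : ∀ x ∈ Ω, 1 ≤ ‖x‖ → ‖F x‖ ^ γ = 0 := fun x hx hx1 => by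
    rw [hF0 x hx hx1, norm_zero, Real.zero_rpow (by linarith)]
  have h1 := hC _ hH hH0
  have hlhs : ∫⁻ x in Ω, ‖‖F x‖ ^ γ‖ₑ ^ p ∂μ = A := by
    refine lintegral_congr fun x => ?_
    rw [Real.enorm_rpow_of_nonneg (norm_nonneg _) (by linarith), enorm_norm,
      ← ENNReal.rpow_mul, hγp]
  have hder : ∀ x ∈ Ω, ‖fderiv ℝ (fun x => ‖F x‖ ^ γ) x‖ₑ ≤
      γ' * (‖F x‖ₑ ^ (γ - 1) * ‖fderiv ℝ F x‖ₑ) := by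
    intro x hx
    have h2 := ((hasFDerivAt_norm_rpow (F x) hγ1).comp x (hdiff x hx).hasFDerivAt).fderiv
    have h3 : ‖fderiv ℝ (fun x : ℝ => ‖x‖ ^ γ) (F x)‖ₑ = γ' * ‖F x‖ₑ ^ (γ - 1) := by
      rw [← ofReal_norm, norm_fderiv_norm_id_rpow _ hγ1,
        ENNReal.ofReal_mul (by linarith), ← ENNReal.ofReal_rpow_of_nonneg (norm_nonneg _) (by linarith),
        ofReal_norm]
      rfl
    rw [show (fun x => ‖F x‖ ^ γ) = (fun x : ℝ => ‖x‖ ^ γ) ∘ F from rfl, h2,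
      ← (hasFDerivAt_norm_rpow (F x) hγ1).fderiv, ← mul_assoc, ← h3]
    exact ContinuousLinearMap.opENorm_comp_le _ _
  have hFm : AEMeasurable (fun x => ‖F x‖ₑ) (μ.restrict Ω) :=
    (hF.continuousOn.aemeasurable hΩ.measurableSet).enorm
  have hDm : AEMeasurable (fun x => ‖fderiv ℝ F x‖ₑ) (μ.restrict Ω) :=
    (measurable_fderiv ℝ F).enorm.aemeasurable
  have hholder := ENNReal.lintegral_mul_le_Lp_mul_Lq (μ.restrict Ω) Real.HolderConjugate.two_two
    (hFm.pow_const (γ - 1)) hDm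
  have hA2 : ∫⁻ x in Ω, (‖F x‖ₑ ^ (γ - 1)) ^ (2 : ℝ) ∂μ = A := by
    refine lintegral_congr fun x => ?_
    rw [← ENNReal.rpow_mul, hγ2]
  rw [hA2, ← hBd] at hholder
  have h4 : A ≤ C * (γ' * (A ^ (1 / 2 : ℝ) * Bd ^ (1 / 2 : ℝ))) ^ p := by
    calc A = ∫⁻ x in Ω, ‖‖F x‖ ^ γ‖ₑ ^ p ∂μ := hlhs.symm
      _ ≤ C * (∫⁻ x in Ω, ‖fderiv ℝ (fun x => ‖F x‖ ^ γ) x‖ₑ ∂μ) ^ p := h1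
      _ ≤ C * (∫⁻ x in Ω, γ' * (‖F x‖ₑ ^ (γ - 1) * ‖fderiv ℝ F x‖ₑ) ∂μ) ^ p := by
          gcongr 2
          exact setLIntegral_mono' hΩ.measurableSet hder
      _ = C * (γ' * ∫⁻ x in Ω, (‖F x‖ₑ ^ (γ - 1) * ‖fderiv ℝ F x‖ₑ) ∂μ) ^ p := by
          rw [lintegral_const_mul' _ _ ENNReal.coe_ne_top]
      _ ≤ _ := by gcongr; exact hholder
  by_cases hA0 : A = 0
  · rw [hA0, ENNReal.zero_rpow_of_pos (by positivity)]
    exact zero_le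
  have hAp0 : A ^ (1 / 2 * p) ≠ 0 := by simp [hA0, hAtop]
  have hAptop : A ^ (1 / 2 * p) ≠ ⊤ := ENNReal.rpow_ne_top_of_nonneg (by positivity) hAtop
  have h5 : A ^ (p / q) ≤ C * (γ' ^ p * (Bd ^ (1 / 2 : ℝ)) ^ p) := by
    rw [← hpq, ENNReal.rpow_sub _ _ hA0 hAtop, ENNReal.rpow_one,
      ENNReal.div_le_iff hAp0 hAptop]
    refine h4.trans_eq ?_
    rw [ENNReal.mul_rpow_of_nonneg _ _ hp0.le, ENNReal.mul_rpow_of_nonneg _ _ hp0.le,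
      ← ENNReal.rpow_mul A]
    ring
  calc A ^ (1 / q) = (A ^ (p / q)) ^ (1 / p) := by
        rw [← ENNReal.rpow_mul]; congr 1; field_simp
    _ ≤ (C * (γ' ^ p * (Bd ^ (1 / 2 : ℝ)) ^ p)) ^ (1 / p) :=
        ENNReal.rpow_le_rpow h5 (by positivity)
    _ = (C * γ' ^ p) ^ (1 / p) * Bd ^ (1 / 2 : ℝ) := by
        rw [← mul_assoc, ENNReal.mul_rpow_of_nonneg _ _ (by positivity), ← ENNReal.rpow_mul _ p,
          mul_one_div_cancel hp0.ne', ENNReal.rpow_one]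
    _ = _ := by
        rw [ENNReal.coe_rpow_of_nonneg _ (by positivity), ENNReal.coe_mul,
          ENNReal.coe_rpow_of_nonneg _ hp0.le]

end Sobolev

/-! ### Sobolev inequality and chain rule in `H_0^1(S_D ∪ Γ₁)` -/

section SectorSpace

variable {N : ℕ} {D : Set (Metric.sphere (0 : EuclideanSpace ℝ (Fin N)) 1)}

lemma norm_gradient {F : Type*} [NormedAddCommGroup F] [InnerProductSpace ℝ F] [CompleteSpace F]
    (f : F → ℝ) (x : F) : ‖gradient f x‖ = ‖fderiv ℝ f x‖ := by
  rw [gradient, LinearIsometryEquiv.norm_map]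

lemma isFiniteMeasure_sectorMeasure (D : Set (Metric.sphere (0 : EuclideanSpace ℝ (Fin N)) 1)) :
    IsFiniteMeasure (sectorMeasure D) := by
  refine ⟨?_⟩
  rw [sectorMeasure, Measure.restrict_apply_univ, sphericalSector_eq]
  exact (measure_mono Set.inter_subset_right).trans_lt measure_ball_lt_top

/-- Points of `D` have norm one and lie inside the open cone, hence neither in the sector nor in
`Γ₁`. This is how compact support in `S_D ∪ Γ₁` encodes the Dirichlet condition on `D`. -/
lemma coe_notMem_closure_support (hD : IsOpen D) {φ : EuclideanSpace ℝ (Fin N) → ℝ}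
    (hφ : IsSectorC1c D φ) {q : Metric.sphere (0 : EuclideanSpace ℝ (Fin N)) 1} (hq : q ∈ D) :
    (q : EuclideanSpace ℝ (Fin N)) ∉
      closure ((sphericalSector D ∪ lateralBoundary D) ∩ Function.support φ) := by
  intro h
  rcases hφ.2 h with h1 | h1
  · rw [sphericalSector_eq] at h1
    simpa using h1.2
  · have h2 := h1.1
    rw [(isOpen_sphericalCone hD).frontier_eq] at h2
    exact h2.2 (coe_mem_sphericalCone_iff.2 hq)

/-- The extension by zero of `φ ∈ C_c^1(S_D ∪ Γ₁)` vanishes near the points of the cone that are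
not in the sector. -/
lemma indicator_sphericalSector_eventuallyEq_zero (hD : IsOpen D)
    {φ : EuclideanSpace ℝ (Fin N) → ℝ} (hφ : IsSectorC1c D φ) {x : EuclideanSpace ℝ (Fin N)}
    (hx : x ∈ sphericalCone D) (hx' : x ∉ sphericalSector D) :
    (sphericalSector D).indicator φ =ᶠ[𝓝 x] fun _ => 0 := by
  have hx1 : 1 ≤ ‖x‖ := by
    by_contra! h
    exact hx' (by rw [sphericalSector_eq]; exact ⟨hx, by simpa using h⟩)
  rcases hx1.eq_or_lt with h1 | h1
  · have hq : (⟨x, by simpa using h1.symm⟩ : Metric.sphere (0 : EuclideanSpace ℝ (Fin N)) 1) ∈ D :=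
      coe_mem_sphericalCone_iff.1 hx
    filter_upwards [isClosed_closure.isOpen_compl.mem_nhds
      (coe_notMem_closure_support hD hφ hq)] with y hy
    by_cases hyS : y ∈ sphericalSector D
    · rw [Set.indicator_of_mem hyS]
      by_contra h
      exact hy (subset_closure ⟨Or.inl hyS, h⟩)
    · rw [Set.indicator_of_notMem hyS]
  · filter_upwards [continuous_norm.continuousAt.eventually (lt_mem_nhds h1)] with y hy
    refine Set.indicator_of_notMem (fun hyS => ?_) _
    rw [sphericalSector_eq] at hyS
    exact absurd hy (not_lt.2 (mem_ball_zero_iff.1 hyS.2).le)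

lemma indicator_sphericalSector_eventuallyEq (hD : IsOpen D)
    (φ : EuclideanSpace ℝ (Fin N) → ℝ) {x : EuclideanSpace ℝ (Fin N)}
    (hx : x ∈ sphericalSector D) : (sphericalSector D).indicator φ =ᶠ[𝓝 x] φ := by
  filter_upwards [(isOpen_sphericalSector hD).mem_nhds hx] with y hy
  exact Set.indicator_of_mem hy _

/-- Regularity holds across `D` but may fail across `Γ₁`, where the extension can jump. The Sobolev
inequality above therefore asks for `C^1` only on the open set. -/
lemma contDiffOn_indicator_sphericalSector (hD : IsOpen D)
    {φ : EuclideanSpace ℝ (Fin N) → ℝ} (hφ : IsSectorC1c D φ) :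
    ContDiffOn ℝ 1 ((sphericalSector D).indicator φ) (sphericalCone D) := by
  intro x hx
  by_cases hxS : x ∈ sphericalSector D
  · exact (hφ.1.contDiffAt.congr_of_eventuallyEq
      (indicator_sphericalSector_eventuallyEq hD φ hxS)).contDiffWithinAt
  · exact (contDiffAt_const.congr_of_eventuallyEq
      (indicator_sphericalSector_eventuallyEq_zero hD hφ hx hxS)).contDiffWithinAt

/-- The Sobolev exponent `2N/(N-2)`. -/
noncomputable def sobolevExponent (N : ℕ) : ℝ := 2 * (N : ℝ) / (N - 2)

lemma sobolevExponent_pos (hN : 3 ≤ N) : 0 < sobolevExponent N := by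
  have hN3 : (3 : ℝ) ≤ N := by exact_mod_cast hN
  have hm2 : (0 : ℝ) < N - 2 := by linarith
  unfold sobolevExponent
  positivity

/-- The Sobolev inequality for `C_c^1(S_D ∪ Γ₁)`. -/
lemma IsSmoothSphericalDomain.exists_sobolev_C1c (hN : 3 ≤ N) (hD : IsSmoothSphericalDomain D) :
    ∃ C : ℝ≥0, ∀ φ, IsSectorC1c D φ →
      eLpNorm φ (ENNReal.ofReal (sobolevExponent N)) (sectorMeasure D) ≤
        C * eLpNorm (gradient φ) 2 (sectorMeasure D) := by
  obtain ⟨B, hB⟩ := hD.exists_finite_bases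
  have hΩ := isOpen_sphericalCone hD.isOpen
  have hS := isOpen_sphericalSector hD.isOpen
  have hSΩ : sphericalSector D ⊆ sphericalCone D := by
    rw [sphericalSector_eq]; exact Set.inter_subset_left
  obtain ⟨C, hC⟩ := exists_sobolev_of_bases (volume : Measure (EuclideanSpace ℝ (Fin N))) hN hΩ hB
  refine ⟨C, fun φ hφ => ?_⟩
  have hq := sobolevExponent_pos hN
  set F := (sphericalSector D).indicator φ with hF
  have hF0 : ∀ x ∈ sphericalCone D, 1 ≤ ‖x‖ → F x = 0 := by
    intro x hx hx1
    refine Set.indicator_of_notMem (fun h => ?_) _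
    rw [sphericalSector_eq] at h
    exact absurd hx1 (not_le.2 (by simpa using h.2))
  have hbd : ∃ K : ℝ≥0, ∀ x ∈ sphericalCone D, ‖F x‖ₑ ≤ K := by
    obtain ⟨K, hK⟩ := (isCompact_closedBall (0 : EuclideanSpace ℝ (Fin N)) 1).exists_bound_of_continuousOn
      hφ.1.continuous.continuousOn
    refine ⟨K.toNNReal, fun x _ => ?_⟩
    by_cases hxS : x ∈ sphericalSector D
    · rw [hF, Set.indicator_of_mem hxS, ← ofReal_norm]
      rw [sphericalSector_eq] at hxS
      exact ENNReal.ofReal_le_ofReal (hK x (Metric.ball_subset_closedBall hxS.2))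
    · rw [hF, Set.indicator_of_notMem hxS]
      simp
  have h1 := hC F (contDiffOn_indicator_sphericalSector hD.isOpen hφ) hF0 hbd
  rw [eLpNorm_eq_lintegral_rpow_enorm_toReal (by simpa using hq) ENNReal.ofReal_ne_top,
    eLpNorm_eq_lintegral_rpow_enorm_toReal two_ne_zero ENNReal.ofNat_ne_top,
    ENNReal.toReal_ofReal hq.le, ENNReal.toReal_ofNat]
  unfold sobolevExponent sectorMeasure at *
  refine le_trans ?_ (h1.trans ?_)
  · refine ENNReal.rpow_le_rpow ?_ (by positivity)
    refine le_trans (le_of_eq ?_) (lintegral_mono_set hSΩ)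
    refine setLIntegral_congr_fun hS.measurableSet fun x hx => ?_
    simp only [hF, Set.indicator_of_mem hx]
  · refine mul_le_mul_right (ENNReal.rpow_le_rpow ?_ (by positivity)) _
    have h2 : ∀ x ∈ sphericalCone D, ‖fderiv ℝ F x‖ₑ ^ (2 : ℝ) =
        (sphericalSector D).indicator (fun x => ‖gradient φ x‖ₑ ^ (2 : ℝ)) x := by
      intro x hx
      by_cases hxS : x ∈ sphericalSector D
      · rw [Set.indicator_of_mem hxS,
          (indicator_sphericalSector_eventuallyEq hD.isOpen φ hxS).fderiv_eq,
          ← ofReal_norm (gradient φ x), norm_gradient, ofReal_norm]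
      · rw [Set.indicator_of_notMem hxS,
          (indicator_sphericalSector_eventuallyEq_zero hD.isOpen hφ hx hxS).fderiv_eq,
          ← ofReal_norm]
        simp
    rw [setLIntegral_congr_fun hΩ.measurableSet h2, setLIntegral_indicator hS.measurableSet,
      Set.inter_eq_left.2 hSΩ]

lemma MemSectorH10.exists_seq_ae_tendsto {u : EuclideanSpace ℝ (Fin N) → ℝ}
    {Du : EuclideanSpace ℝ (Fin N) → EuclideanSpace ℝ (Fin N)} (h : MemSectorH10 D u Du) :
    ∃ φ : ℕ → EuclideanSpace ℝ (Fin N) → ℝ, (∀ n, IsSectorC1c D (φ n)) ∧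
      Tendsto (fun n => eLpNorm (fun x => φ n x - u x) 2 (sectorMeasure D)) atTop (𝓝 0) ∧
      Tendsto (fun n => eLpNorm (fun x => gradient (φ n) x - Du x) 2 (sectorMeasure D))
        atTop (𝓝 0) ∧
      ∀ᵐ x ∂(sectorMeasure D), Tendsto (fun n => φ n x) atTop (𝓝 (u x)) := by
  obtain ⟨hu, hDu, φ, hφ, h1, h2⟩ := h
  have hm : TendstoInMeasure (sectorMeasure D) φ atTop u :=
    tendstoInMeasure_of_tendsto_eLpNorm two_ne_zero
      (fun n => (hφ n).1.continuous.aestronglyMeasurable) hu.1 h1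
  obtain ⟨ns, hns, hae⟩ := hm.exists_seq_tendsto_ae
  exact ⟨fun n => φ (ns n), fun n => hφ _, h1.comp hns.tendsto_atTop,
    h2.comp hns.tendsto_atTop, hae⟩

lemma continuous_gradient {φ : EuclideanSpace ℝ (Fin N) → ℝ} (hφ : ContDiff ℝ 1 φ) :
    Continuous (gradient φ) :=
  (InnerProductSpace.toDual ℝ _).symm.continuous.comp (hφ.continuous_fderiv one_ne_zero)

/-- The Sobolev inequality for `H_0^1(S_D ∪ Γ₁)`. -/
lemma IsSmoothSphericalDomain.exists_sobolev (hN : 3 ≤ N) (hD : IsSmoothSphericalDomain D) :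
    ∃ C : ℝ≥0, ∀ u Du, MemSectorH10 D u Du →
      eLpNorm u (ENNReal.ofReal (sobolevExponent N)) (sectorMeasure D) ≤
        C * eLpNorm Du 2 (sectorMeasure D) := by
  obtain ⟨C, hC⟩ := hD.exists_sobolev_C1c hN
  refine ⟨C, fun u Du h => ?_⟩
  obtain ⟨φ, hφ, -, h2, hae⟩ := h.exists_seq_ae_tendsto
  have hlim : Tendsto (fun n => (C : ℝ≥0∞) * (eLpNorm (fun x => gradient (φ n) x - Du x) 2
      (sectorMeasure D) + eLpNorm Du 2 (sectorMeasure D))) atTop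
      (𝓝 (C * (0 + eLpNorm Du 2 (sectorMeasure D)))) :=
    ENNReal.Tendsto.const_mul (h2.add tendsto_const_nhds) (Or.inr ENNReal.coe_ne_top)
  rw [zero_add] at hlim
  -- Fatou: the left side is lower semicontinuous under a.e. convergence, while the gradient norms
  -- are controlled by `L²` convergence.
  refine (Lp.eLpNorm_lim_le_liminf_eLpNorm
    (fun n => (hφ n).1.continuous.aestronglyMeasurable) u hae).trans ?_
  rw [← hlim.liminf_eq]
  refine liminf_le_liminf (Eventually.of_forall fun n => (hC _ (hφ n)).trans ?_)
  gcongr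
  have h3 := eLpNorm_add_le (μ := sectorMeasure D) (p := 2)
    (((continuous_gradient (hφ n).1).aestronglyMeasurable).sub h.2.1.1) h.2.1.1 one_le_two
  rwa [sub_add_cancel] at h3

/-- Dominated convergence in `L²` for products of a bounded sequence with a fixed function. -/
lemma tendsto_eLpNorm_smul_of_ae_tendsto {α E : Type*} [MeasurableSpace α] {μ : Measure α}
    [NormedAddCommGroup E] [NormedSpace ℝ E] {c : ℕ → α → ℝ} {f : α → E} {K : ℝ≥0}
    (hc : ∀ n, AEStronglyMeasurable (c n) μ) (hf : MemLp f 2 μ) (hK : ∀ n x, ‖c n x‖ₑ ≤ K)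
    (hlim : ∀ᵐ x ∂μ, Tendsto (fun n => c n x) atTop (𝓝 0)) :
    Tendsto (fun n => eLpNorm (fun x => c n x • f x) 2 μ) atTop (𝓝 0) := by
  simp only [eLpNorm_eq_lintegral_rpow_enorm_toReal two_ne_zero ENNReal.ofNat_ne_top,
    ENNReal.toReal_ofNat]
  have hfin : ∫⁻ x, ‖f x‖ₑ ^ (2 : ℝ) ∂μ ≠ ⊤ := by
    have := lintegral_rpow_enorm_lt_top_of_eLpNorm_lt_top two_ne_zero ENNReal.ofNat_ne_top hf.2
    simpa using this.ne
  have key : Tendsto (fun n => ∫⁻ x, ‖c n x • f x‖ₑ ^ (2 : ℝ) ∂μ) atTop (𝓝 (∫⁻ _, 0 ∂μ)) := by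
    refine tendsto_lintegral_of_dominated_convergence'
      (fun x => (K : ℝ≥0∞) ^ (2 : ℝ) * ‖f x‖ₑ ^ (2 : ℝ))
      (fun n => (((hc n).smul hf.1).enorm.pow_const _)) (fun n => ?_) ?_ ?_
    · refine Eventually.of_forall fun x => ?_
      simp only [enorm_smul]
      rw [ENNReal.mul_rpow_of_nonneg _ _ zero_le_two]
      gcongr
      exact hK n x
    · rw [lintegral_const_mul' _ _ (by simp)]
      exact ENNReal.mul_ne_top (by simp) hfin
    · filter_upwards [hlim] with x hx
      have h1 : Tendsto (fun n => ‖c n x • f x‖ₑ) atTop (𝓝 0) := by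
        have := (hx.smul_const (f x)).enorm
        simpa using this
      have := (ENNReal.continuous_rpow_const (y := 2)).tendsto 0 |>.comp h1
      simpa [Function.comp_def] using this
  rw [lintegral_zero] at key
  have := (ENNReal.continuous_rpow_const (y := 1 / 2)).tendsto 0 |>.comp key
  simpa [Function.comp_def] using this

lemma gradient_comp {Φ : ℝ → ℝ} (hΦ : Differentiable ℝ Φ) {φ : EuclideanSpace ℝ (Fin N) → ℝ}
    (hφ : Differentiable ℝ φ) (x : EuclideanSpace ℝ (Fin N)) :
    gradient (fun x => Φ (φ x)) x = deriv Φ (φ x) • gradient φ x := by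
  have h : fderiv ℝ (fun x => Φ (φ x)) x = deriv Φ (φ x) • fderiv ℝ φ x :=
    ((hΦ (φ x)).hasDerivAt.comp_hasFDerivAt x (hφ x).hasFDerivAt).fderiv
  rw [gradient, gradient, h]
  simp

/-- The chain rule in `H_0^1(S_D ∪ Γ₁)`. -/
lemma MemSectorH10.comp {u : EuclideanSpace ℝ (Fin N) → ℝ}
    {Du : EuclideanSpace ℝ (Fin N) → EuclideanSpace ℝ (Fin N)} (h : MemSectorH10 D u Du)
    {Φ : ℝ → ℝ} (hΦ : ContDiff ℝ 1 Φ) (hΦ0 : Φ 0 = 0) (hΦ1 : ∀ s, ‖deriv Φ s‖ ≤ 1) :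
    MemSectorH10 D (fun x => Φ (u x)) (fun x => deriv Φ (u x) • Du x) := by
  obtain ⟨φ, hφ, h1, h2, hae⟩ := h.exists_seq_ae_tendsto
  obtain ⟨hu, hDu, -⟩ := h
  have hdc : Continuous (deriv Φ) := hΦ.continuous_deriv le_rfl
  have hΦd : Differentiable ℝ Φ := hΦ.differentiable one_ne_zero
  have hlip : LipschitzWith 1 Φ := lipschitzWith_of_nnnorm_deriv_le hΦd hΦ1
  have hlip' : ∀ a b, ‖Φ a - Φ b‖ ≤ ‖a - b‖ := fun a b => by
    simpa [dist_eq_norm] using hlip.dist_le_mul a b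
  refine ⟨hu.mono (hΦ.continuous.comp_aestronglyMeasurable hu.1) (Eventually.of_forall fun x => ?_),
    hDu.mono ((hdc.comp_aestronglyMeasurable hu.1).smul hDu.1) (Eventually.of_forall fun x => ?_),
    fun n x => Φ (φ n x), fun n => ⟨hΦ.comp (hφ n).1, ?_⟩, ?_, ?_⟩
  · simpa [hΦ0] using hlip' (u x) 0
  · simp only [norm_smul]
    exact mul_le_of_le_one_left (norm_nonneg _) (hΦ1 _)
  -- `Φ 0 = 0` prevents the support from growing.
  · refine (closure_mono ?_).trans (hφ n).2
    refine Set.inter_subset_inter_right _ fun x hx hx0 => hx ?_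
    simp only [hx0, hΦ0]
  · exact tendsto_of_tendsto_of_tendsto_of_le_of_le tendsto_const_nhds h1 (fun _ => zero_le)
      fun n => eLpNorm_mono fun x => hlip' _ _
  -- As `deriv Φ` is only continuous, the slopes converge merely a.e.; their difference is at most
  -- `2`, so dominated convergence against `Du` applies.
  · have h3 : Tendsto (fun n => eLpNorm (fun x => (deriv Φ (φ n x) - deriv Φ (u x)) • Du x) 2
        (sectorMeasure D)) atTop (𝓝 0) := by
      refine tendsto_eLpNorm_smul_of_ae_tendsto (K := 2) (fun n => ?_) hDu (fun n x => ?_) ?_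
      · exact (hdc.comp (hφ n).1.continuous).aestronglyMeasurable.sub
          (hdc.comp_aestronglyMeasurable hu.1)
      · rw [← ofReal_norm]
        refine ENNReal.ofReal_le_of_le_toReal ?_
        refine (norm_sub_le _ _).trans ?_
        have := hΦ1 (φ n x)
        have := hΦ1 (u x)
        simp only [ENNReal.coe_ofNat, ENNReal.toReal_ofNat]
        linarith
      · filter_upwards [hae] with x hx
        simpa using ((hdc.tendsto (u x)).comp hx).sub_const (deriv Φ (u x))
    have h4 := h2.add h3
    rw [add_zero] at h4
    refine tendsto_of_tendsto_of_tendsto_of_le_of_le tendsto_const_nhds h4 (fun _ => zero_le)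
      fun n => ?_
    have hgm : AEStronglyMeasurable (gradient (φ n)) (sectorMeasure D) :=
      (continuous_gradient (hφ n).1).aestronglyMeasurable
    have hdn : AEStronglyMeasurable (fun x => deriv Φ (φ n x)) (sectorMeasure D) :=
      (hdc.comp (hφ n).1.continuous).aestronglyMeasurable
    have hdu : AEStronglyMeasurable (fun x => deriv Φ (u x)) (sectorMeasure D) :=
      hdc.comp_aestronglyMeasurable hu.1
    calc eLpNorm (fun x => gradient (fun x => Φ (φ n x)) x - deriv Φ (u x) • Du x) 2
          (sectorMeasure D)
        = eLpNorm ((fun x => deriv Φ (φ n x) • (gradient (φ n) x - Du x)) +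
            fun x => (deriv Φ (φ n x) - deriv Φ (u x)) • Du x) 2 (sectorMeasure D) := by
          congr 1
          ext1 x
          rw [gradient_comp hΦd ((hφ n).1.differentiable one_ne_zero), Pi.add_apply, smul_sub,
            sub_smul]
          abel
      _ ≤ _ := eLpNorm_add_le (hdn.smul (hgm.sub hDu.1)) ((hdn.sub hdu).smul hDu.1) one_le_two
      _ ≤ _ := by
          refine add_le_add_left (eLpNorm_mono fun x => ?_) _
          rw [norm_smul]
          exact mul_le_of_le_one_left (norm_nonneg _) (hΦ1 _)

end SectorSpace

/-! ### Truncation and De Giorgi iteration -/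

section LevelSets

lemma hasDerivAt_max_zero_sq (x : ℝ) : HasDerivAt (fun x : ℝ => max x 0 ^ 2) (2 * max x 0) x := by
  rcases lt_trichotomy x 0 with h | rfl | h
  · rw [max_eq_right h.le, mul_zero]
    refine (hasDerivAt_const x (0 : ℝ)).congr_of_eventuallyEq ?_
    filter_upwards [gt_mem_nhds h] with y hy
    simp [max_eq_right hy.le]
  · rw [max_self, mul_zero, hasDerivAt_iff_isLittleO]
    simp only [max_self, sub_zero, smul_zero]
    have h1 : (fun x : ℝ => max x 0 ^ 2 - 0 ^ 2) =O[𝓝 0] fun x : ℝ => x ^ 2 := by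
      refine Asymptotics.IsBigO.of_bound 1 (Eventually.of_forall fun y => ?_)
      rcases le_total y 0 with hy | hy
      · simp [max_eq_right hy, sq_nonneg]
      · simp [max_eq_left hy]
    exact h1.trans_isLittleO (Asymptotics.isLittleO_pow_id one_lt_two)
  · rw [max_eq_left h.le]
    have h1 : HasDerivAt (fun x : ℝ => x ^ 2) (2 * x) x := by simpa using hasDerivAt_pow 2 x
    refine h1.congr_of_eventuallyEq ?_
    filter_upwards [lt_mem_nhds h] with y hy
    simp [max_eq_left (le_of_lt hy)]

/-- A `C¹` approximation of `s ↦ (s - k)₊`, with slopes in `[0, 1]`. -/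
noncomputable def smoothTruncation (k δ s : ℝ) : ℝ :=
  (max (s - k) 0 ^ 2 - max (s - k - δ) 0 ^ 2) / (2 * δ)

lemma hasDerivAt_smoothTruncation {k δ : ℝ} (hδ : 0 < δ) (s : ℝ) :
    HasDerivAt (smoothTruncation k δ) ((max (s - k) 0 - max (s - k - δ) 0) / δ) s := by
  have h1 : HasDerivAt (fun s : ℝ => max (s - k) 0 ^ 2) (2 * max (s - k) 0) s :=
    (hasDerivAt_max_zero_sq (s - k)).comp_sub_const s k
  have h2 : HasDerivAt (fun s : ℝ => max (s - k - δ) 0 ^ 2) (2 * max (s - k - δ) 0) s := by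
    simp only [sub_sub]
    exact (hasDerivAt_max_zero_sq (s - (k + δ))).comp_sub_const s (k + δ)
  refine HasDerivAt.congr_deriv (f := smoothTruncation k δ) ((h1.fun_sub h2).div_const (2 * δ)) ?_
  field_simp

lemma contDiff_smoothTruncation {k δ : ℝ} (hδ : 0 < δ) : ContDiff ℝ 1 (smoothTruncation k δ) := by
  rw [contDiff_one_iff_deriv]
  refine ⟨fun s => (hasDerivAt_smoothTruncation hδ s).differentiableAt, ?_⟩
  rw [funext fun s => (hasDerivAt_smoothTruncation (k := k) hδ s).deriv]
  fun_prop

lemma deriv_smoothTruncation_nonneg {k δ : ℝ} (hδ : 0 < δ) (s : ℝ) :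
    0 ≤ deriv (smoothTruncation k δ) s := by
  rw [(hasDerivAt_smoothTruncation hδ s).deriv]
  exact div_nonneg (sub_nonneg.2 (max_le_max_right _ (by linarith))) hδ.le

lemma deriv_smoothTruncation_le_one {k δ : ℝ} (hδ : 0 < δ) (s : ℝ) :
    deriv (smoothTruncation k δ) s ≤ 1 := by
  rw [(hasDerivAt_smoothTruncation hδ s).deriv, div_le_one hδ]
  rcases le_total (s - k) 0 with h | h
  · rw [max_eq_right h]; linarith [le_max_right (s - k - δ) 0]
  · rw [max_eq_left h]; linarith [le_max_left (s - k - δ) 0]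

lemma smoothTruncation_nonneg {k δ : ℝ} (hδ : 0 < δ) (s : ℝ) : 0 ≤ smoothTruncation k δ s := by
  refine div_nonneg (sub_nonneg.2 ?_) (by linarith)
  have : max (s - k - δ) 0 ≤ max (s - k) 0 := max_le_max_right _ (by linarith)
  exact pow_le_pow_left₀ (le_max_right _ _) this 2

lemma smoothTruncation_of_le {k δ s : ℝ} (hδ : 0 < δ) (h : s ≤ k) : smoothTruncation k δ s = 0 := by
  rw [smoothTruncation, max_eq_right (by linarith : s - k ≤ 0),
    max_eq_right (by linarith : s - k - δ ≤ 0)]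
  simp

/-- Smoothing loses at most `δ`. This serves twice: to bound `u` by `w + k + δ` in the energy
inequality, and to get `w ≥ δ` where `u > k + 2 * δ`. -/
lemma sub_sub_le_smoothTruncation {k δ : ℝ} (hδ : 0 < δ) (s : ℝ) :
    s - k - δ ≤ smoothTruncation k δ s := by
  rcases le_total (s - k - δ) 0 with h | h
  · exact h.trans (smoothTruncation_nonneg hδ s)
  · rw [smoothTruncation, max_eq_left h, max_eq_left (by linarith : 0 ≤ s - k),
      le_div_iff₀ (by linarith)]
    nlinarith

/-- Hölder's inequality for three factors, the third being an indicator function. -/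
lemma lintegral_mul_rpow_le_of_support {α : Type*} [MeasurableSpace α] {μ : Measure α}
    {f w : α → ℝ≥0∞} (hf : AEMeasurable f μ) (hw : AEMeasurable w μ) {A : Set α}
    (hA : NullMeasurableSet A μ) (hwA : ∀ x ∉ A, w x = 0) {s q j : ℝ} (hs : 0 < s) (hq : 0 < q)
    (hj : 0 < j) (hθ : 0 < 1 - 1 / s - j / q) :
    ∫⁻ x, f x * w x ^ j ∂μ ≤ (∫⁻ x, f x ^ s ∂μ) ^ (1 / s) *
      ((∫⁻ x, w x ^ q ∂μ) ^ (1 / q)) ^ j * μ A ^ (1 - 1 / s - j / q) := by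
  have h := ENNReal.lintegral_prod_norm_pow_le (μ := μ) (Finset.univ : Finset (Fin 3))
    (f := ![fun x => f x ^ s, fun x => w x ^ q, A.indicator 1])
    (p := ![1 / s, j / q, 1 - 1 / s - j / q]) ?_ ?_ ?_
  · simp only [Fin.prod_univ_three, Matrix.cons_val_zero, Matrix.cons_val_one,
      Matrix.cons_val] at h
    rw [lintegral_indicator_one₀ hA] at h
    rw [← ENNReal.rpow_mul, one_div_mul_eq_div]
    refine le_trans (lintegral_mono fun x => ?_) h
    rw [← ENNReal.rpow_mul, ← ENNReal.rpow_mul, mul_one_div_cancel hs.ne', ENNReal.rpow_one,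
      mul_div_cancel₀ _ hq.ne']
    by_cases hx : x ∈ A
    · simp [hx]
    · simp [hwA x hx, hj]
  · intro i _
    fin_cases i
    · exact hf.pow_const s
    · exact hw.pow_const q
    · exact (aemeasurable_const (b := (1 : ℝ≥0∞))).indicator₀ hA
  · simp [Fin.sum_univ_three]
  · intro i _
    fin_cases i
    · exact (one_div_pos.2 hs).le
    · exact (div_pos hj hq).le
    · exact hθ.le

/-- Fast geometric convergence: a sequence with `φ (n+1) ≤ (Q 2ⁿ) ^ q φ n ^ β`, `β > 1`, tends to
zero if it starts small enough. -/
lemma exists_pos_forall_tendsto_zero (Q K θ q β : ℝ) (hQ : 0 ≤ Q) (hθ : 0 < θ) (hq : 0 < q)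
    (hβ : 1 < β) : ∃ κ > 0, ∀ φ : ℕ → ℝ, (∀ n, 0 ≤ φ n) → φ 0 ≤ κ →
      (∀ n, K * φ n ^ θ ≤ 1 / 2 → φ (n + 1) ≤ (Q * 2 ^ n) ^ q * φ n ^ β) →
      Tendsto φ atTop (𝓝 0) := by
  -- The ratio for which `2 ^ q * l ^ (β - 1) = 1`: the superlinear gain exactly cancels the growth
  -- `2 ^ (n q)`, and `φ n ≤ κ * l ^ n` propagates by induction.
  set l : ℝ := 2 ^ (-(q / (β - 1))) with hl
  have hβ' : 0 < β - 1 := by linarith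
  have hl0 : 0 < l := by positivity
  have hl1 : l < 1 := by
    rw [hl]
    exact Real.rpow_lt_one_of_one_lt_of_neg one_lt_two (by linarith [div_pos hq hβ'])
  have hl2 : (2 : ℝ) ^ q * l ^ (β - 1) = 1 := by
    rw [hl, ← Real.rpow_mul zero_le_two, ← Real.rpow_add two_pos]
    have : q + -(q / (β - 1)) * (β - 1) = 0 := by field_simp; ring
    rw [this, Real.rpow_zero]
  clear_value l
  have hlim : ∀ (c e : ℝ), 0 < e → Tendsto (fun κ : ℝ => c * κ ^ e) (𝓝[>] 0) (𝓝 0) := by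
    intro c e he
    have h1 : Tendsto (fun κ : ℝ => κ ^ e) (𝓝 0) (𝓝 0) := by
      simpa [Real.zero_rpow he.ne'] using (Real.continuousAt_rpow_const 0 e (Or.inr he.le)).tendsto
    simpa using (h1.mono_left nhdsWithin_le_nhds).const_mul c
  -- `κ` small enough for the smallness hypothesis at every step and for `Q ^ q * κ ^ (β - 1) < l`.
  -- It does not depend on the sequence, which makes the final constant independent of `u`.
  obtain ⟨κ, hκ1, hκ2, hκ0⟩ := (((hlim |K| θ hθ).eventually_lt_const (one_half_pos)).and
    (((hlim (Q ^ q) (β - 1) hβ').eventually_lt_const hl0).and self_mem_nhdsWithin)).exists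
  refine ⟨κ, hκ0, fun φ hφ h0 hstep => ?_⟩
  have key : ∀ n, φ n ≤ κ * l ^ n := by
    intro n
    induction n with
    | zero => simpa using h0
    | succ n ih =>
      have hle : φ n ≤ κ := ih.trans (mul_le_of_le_one_right hκ0.le (pow_le_one₀ hl0.le hl1.le))
      have h1 : K * φ n ^ θ ≤ 1 / 2 := by
        calc K * φ n ^ θ ≤ |K| * κ ^ θ := by
              gcongr
              · exact Real.rpow_nonneg (hφ n) _
              · exact le_abs_self K
              · exact hφ n
          _ ≤ 1 / 2 := hκ1.le
      have hln : 0 < l ^ n := by positivity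
      calc φ (n + 1) ≤ (Q * 2 ^ n) ^ q * φ n ^ β := hstep n h1
        _ ≤ (Q * 2 ^ n) ^ q * (κ * l ^ n) ^ β := by
            gcongr
            exact hφ n
        _ = κ * l ^ n * (Q ^ q * κ ^ (β - 1)) * ((2 : ℝ) ^ q * l ^ (β - 1)) ^ n := by
            rw [Real.mul_rpow hQ (by positivity), Real.mul_rpow hκ0.le hln.le, mul_pow,
              ← Real.rpow_natCast (2 ^ q), ← Real.rpow_natCast (l ^ (β - 1)),
              ← Real.rpow_natCast l, ← Real.rpow_natCast 2, ← Real.rpow_mul zero_le_two,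
              ← Real.rpow_mul zero_le_two, ← Real.rpow_mul hl0.le, ← Real.rpow_mul hl0.le,
              Real.rpow_sub hκ0, Real.rpow_one, sub_mul, one_mul, Real.rpow_sub hl0,
              mul_comm q, mul_comm β]
            field_simp
        _ ≤ κ * l ^ n * l * ((2 : ℝ) ^ q * l ^ (β - 1)) ^ n := by gcongr
        _ = κ * l ^ (n + 1) := by rw [hl2, one_pow, mul_one, pow_succ, mul_assoc]
  refine squeeze_zero hφ key ?_
  simpa using (tendsto_pow_atTop_nhds_zero_of_lt_one hl0.le hl1).const_mul κ

variable {α : Type*} [MeasurableSpace α] {μ : Measure α} [IsFiniteMeasure μ]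

/-- The energy inequality on level sets gives a decay estimate for the distribution function. -/
lemma measureReal_levelSet_le {q s : ℝ} (hs : 0 < s) (hq : 0 < q)
    (hqs : 0 < 1 - 1 / s - 2 / q) {K M : ℝ≥0} {u c₁ c₂ : α → ℝ}
    (hu : MemLp u (ENNReal.ofReal q) μ) (hu0 : ∀ᵐ x ∂μ, 0 < u x)
    (hc₁ : MemLp c₁ (ENNReal.ofReal s) μ) (hM : eLpNorm c₁ (ENNReal.ofReal s) μ ≤ M)
    (hc₂ : MemLp c₂ (ENNReal.ofReal s) μ) {k δ : ℝ} (hk : 0 ≤ k) (hδ : 0 < δ)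
    (henergy : eLpNorm (fun x => smoothTruncation k δ (u x)) (ENNReal.ofReal q) μ ^ 2 ≤
      K * ∫⁻ x, (‖c₁ x‖ₑ * ‖u x‖ₑ + ‖c₂ x‖ₑ) * ‖smoothTruncation k δ (u x)‖ₑ ∂μ)
    (hsmall : K * M * μ.real {x | k < u x} ^ (1 - 1 / s - 2 / q) ≤ 1 / 2) :
    μ.real {x | k + 2 * δ < u x} ≤
      (2 * K * ((k + δ) * M + (eLpNorm c₂ (ENNReal.ofReal s) μ).toReal) / δ) ^ q *
        μ.real {x | k < u x} ^ (q * (1 - 1 / s) - 1) := by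
  set w : α → ℝ := fun x => smoothTruncation k δ (u x) with hw
  set A : Set α := {x | k < u x} with hA
  set X := eLpNorm w (ENNReal.ofReal q) μ with hX
  set m := eLpNorm c₁ (ENNReal.ofReal s) μ with hm
  set H := eLpNorm c₂ (ENNReal.ofReal s) μ with hH
  have hnorm : ∀ (f : α → ℝ) {r : ℝ}, 0 < r →
      eLpNorm f (ENNReal.ofReal r) μ = (∫⁻ x, ‖f x‖ₑ ^ r ∂μ) ^ (1 / r) := by
    intro f r hr
    rw [eLpNorm_eq_lintegral_rpow_enorm_toReal (by simpa using hr) ENNReal.ofReal_ne_top,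
      ENNReal.toReal_ofReal hr.le]
  have hwm : AEStronglyMeasurable w μ :=
    (contDiff_smoothTruncation hδ).continuous.comp_aestronglyMeasurable hu.1
  have hAm : NullMeasurableSet A μ := nullMeasurableSet_lt aemeasurable_const hu.1.aemeasurable
  have hw0 : ∀ x, 0 ≤ w x := fun x => smoothTruncation_nonneg hδ _
  have hwA : ∀ x ∉ A, ‖w x‖ₑ = 0 := by
    intro x hx
    rw [hw]
    simp [smoothTruncation_of_le hδ (not_lt.1 hx)]
  have hwu : ∀ᵐ x ∂μ, ‖w x‖ ≤ ‖u x‖ := by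
    filter_upwards [hu0] with x hx
    rw [Real.norm_of_nonneg (hw0 x), Real.norm_of_nonneg hx.le]
    have hlip : LipschitzWith 1 (smoothTruncation k δ) :=
      lipschitzWith_of_nnnorm_deriv_le (contDiff_smoothTruncation hδ |>.differentiable one_ne_zero)
        fun s => by
          rw [← NNReal.coe_le_coe, coe_nnnorm,
            Real.norm_of_nonneg (deriv_smoothTruncation_nonneg hδ s)]
          exact deriv_smoothTruncation_le_one hδ s
    have := hlip.dist_le_mul (u x) 0
    rw [smoothTruncation_of_le hδ hk] at this
    simpa [Real.dist_eq, abs_of_nonneg hx.le, abs_of_nonneg (smoothTruncation_nonneg hδ _)]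
      using this
  have hwq : MemLp w (ENNReal.ofReal q) μ := hu.mono hwm hwu
  have hθ1 : 0 < 1 - 1 / s - 1 / q := by
    have h21 : 2 / q = 1 / q + 1 / q := by ring
    linarith [one_div_pos.2 hq]
  have hholder : ∀ (f : α → ℝ), AEStronglyMeasurable f μ → ∀ j : ℝ, 0 < j →
      0 < 1 - 1 / s - j / q →
      ∫⁻ x, ‖f x‖ₑ * ‖w x‖ₑ ^ j ∂μ ≤
        eLpNorm f (ENNReal.ofReal s) μ * X ^ j * μ A ^ (1 - 1 / s - j / q) := by
    intro f hf j hj hθ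
    rw [hX, hnorm f hs, hnorm w hq]
    exact lintegral_mul_rpow_le_of_support hf.enorm hwm.enorm hAm hwA hs hq hj hθ
  have hsplit : ∫⁻ x, (‖c₁ x‖ₑ * ‖u x‖ₑ + ‖c₂ x‖ₑ) * ‖w x‖ₑ ∂μ ≤
      m * X ^ (2 : ℝ) * μ A ^ (1 - 1 / s - 2 / q) +
        (ENNReal.ofReal (k + δ) * (m * X ^ (1 : ℝ) * μ A ^ (1 - 1 / s - 1 / q)) +
        H * X ^ (1 : ℝ) * μ A ^ (1 - 1 / s - 1 / q)) := by
    have hc1m := hc₁.1.enorm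
    have hc2m := hc₂.1.enorm
    have hwm' := hwm.enorm
    calc ∫⁻ x, (‖c₁ x‖ₑ * ‖u x‖ₑ + ‖c₂ x‖ₑ) * ‖w x‖ₑ ∂μ
        ≤ ∫⁻ x, ‖c₁ x‖ₑ * ‖w x‖ₑ ^ (2 : ℝ) + (ENNReal.ofReal (k + δ) *
            (‖c₁ x‖ₑ * ‖w x‖ₑ ^ (1 : ℝ)) + ‖c₂ x‖ₑ * ‖w x‖ₑ ^ (1 : ℝ)) ∂μ := by
          refine lintegral_mono_ae ?_
          filter_upwards [hu0] with x hx
          have h1 : ‖u x‖ₑ ≤ ‖w x‖ₑ + ENNReal.ofReal (k + δ) := by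
            rw [Real.enorm_eq_ofReal hx.le, Real.enorm_eq_ofReal (hw0 x),
              ← ENNReal.ofReal_add (hw0 x) (by linarith)]
            refine ENNReal.ofReal_le_ofReal ?_
            have := sub_sub_le_smoothTruncation (k := k) hδ (u x)
            simp only [hw]
            linarith
          calc (‖c₁ x‖ₑ * ‖u x‖ₑ + ‖c₂ x‖ₑ) * ‖w x‖ₑ
              ≤ (‖c₁ x‖ₑ * (‖w x‖ₑ + ENNReal.ofReal (k + δ)) + ‖c₂ x‖ₑ) * ‖w x‖ₑ := by gcongr
            _ = _ := by
                rw [ENNReal.rpow_two, ENNReal.rpow_one]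
                ring
      _ = ∫⁻ x, ‖c₁ x‖ₑ * ‖w x‖ₑ ^ (2 : ℝ) ∂μ + (ENNReal.ofReal (k + δ) *
            ∫⁻ x, ‖c₁ x‖ₑ * ‖w x‖ₑ ^ (1 : ℝ) ∂μ + ∫⁻ x, ‖c₂ x‖ₑ * ‖w x‖ₑ ^ (1 : ℝ) ∂μ) := by
          rw [lintegral_add_left' (by fun_prop), lintegral_add_left' (by fun_prop),
            lintegral_const_mul' _ _ ENNReal.ofReal_ne_top]
      _ ≤ _ := by
          gcongr
          · exact hholder c₁ hc₁.1 2 two_pos hqs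
          · exact hholder c₁ hc₁.1 1 one_pos hθ1
          · exact hholder c₂ hc₂.1 1 one_pos hθ1
  have hmain := henergy.trans (mul_le_mul_right hsplit (K : ℝ≥0∞))
  have hXtop : X ≠ ⊤ := hwq.2.ne
  have hmtop : m ≠ ⊤ := hc₁.2.ne
  have hHtop : H ≠ ⊤ := hc₂.2.ne
  have hreal : X.toReal ^ 2 ≤ K * (m.toReal * X.toReal ^ 2 * μ.real A ^ (1 - 1 / s - 2 / q) +
      ((k + δ) * (m.toReal * X.toReal * μ.real A ^ (1 - 1 / s - 1 / q)) +
        H.toReal * X.toReal * μ.real A ^ (1 - 1 / s - 1 / q))) := by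
    have hAt : μ A ≠ ⊤ := measure_ne_top μ A
    have hA1 : μ A ^ (1 - 1 / s - 1 / q) ≠ ⊤ := ENNReal.rpow_ne_top_of_nonneg hθ1.le hAt
    have hA2 : μ A ^ (1 - 1 / s - 2 / q) ≠ ⊤ := ENNReal.rpow_ne_top_of_nonneg hqs.le hAt
    rw [ENNReal.rpow_one, ENNReal.rpow_two] at hmain
    have h := ENNReal.toReal_mono (by finiteness) hmain
    rw [ENNReal.toReal_mul, ENNReal.toReal_add (by finiteness) (by finiteness),
      ENNReal.toReal_add (by finiteness) (by finiteness)] at h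
    simpa [ENNReal.toReal_mul, ENNReal.toReal_pow, ← ENNReal.toReal_rpow,
      ENNReal.toReal_ofReal (by linarith : 0 ≤ k + δ), measureReal_def] using h
  have hmM : m.toReal ≤ M := ENNReal.toReal_le_coe_of_le_coe hM
  set x := X.toReal with hx
  have hx0 : 0 ≤ x := ENNReal.toReal_nonneg
  set a2 := μ.real A ^ (1 - 1 / s - 2 / q) with ha2
  set a1 := μ.real A ^ (1 - 1 / s - 1 / q) with ha1
  have ha20 : 0 ≤ a2 := Real.rpow_nonneg measureReal_nonneg _
  have ha10 : 0 ≤ a1 := Real.rpow_nonneg measureReal_nonneg _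
  have hH0 : 0 ≤ H.toReal := ENNReal.toReal_nonneg
  have hK0 : (0 : ℝ) ≤ K := K.2
  -- `hsmall` absorbs the quadratic term into half of `x ^ 2`; then divide by `x`, finite because `u
  -- ∈ L^q`.
  have hxle : x ≤ 2 * K * ((k + δ) * M + H.toReal) * a1 := by
    have h1 : x ^ 2 ≤ 1 / 2 * x ^ 2 + K * ((k + δ) * M + H.toReal) * a1 * x := by
      calc x ^ 2 ≤ _ := hreal
        _ ≤ K * (M * x ^ 2 * a2 + ((k + δ) * (M * x * a1) + H.toReal * x * a1)) := by gcongr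
        _ = K * M * a2 * x ^ 2 + K * ((k + δ) * M + H.toReal) * a1 * x := by ring
        _ ≤ _ := by gcongr
    rcases hx0.eq_or_lt with h0 | h0
    · rw [← h0]
      positivity
    · have h2 : x * x ≤ (2 * K * ((k + δ) * M + H.toReal) * a1) * x := by linarith
      exact le_of_mul_le_mul_right h2 h0
  have hcheb : δ ^ q * μ.real {x | k + 2 * δ < u x} ≤ x ^ q := by
    have h1 := mul_meas_ge_le_pow_eLpNorm' μ (p := ENNReal.ofReal q) (by simpa using hq)
      ENNReal.ofReal_ne_top hwm (ENNReal.ofReal δ)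
    rw [ENNReal.toReal_ofReal hq.le, ← hX] at h1
    have h2 : μ {x | k + 2 * δ < u x} ≤ μ {x | ENNReal.ofReal δ ≤ ‖w x‖ₑ} := by
      refine measure_mono fun x hx => ?_
      simp only [Set.mem_ofPred_eq] at hx ⊢
      rw [Real.enorm_eq_ofReal (hw0 x)]
      refine ENNReal.ofReal_le_ofReal ?_
      have := sub_sub_le_smoothTruncation (k := k) hδ (u x)
      simp only [hw]
      linarith
    have h3 := ENNReal.toReal_mono (ENNReal.rpow_ne_top_of_nonneg hq.le hXtop)
      ((mul_le_mul_right h2 (ENNReal.ofReal δ ^ q)).trans h1)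
    simpa [ENNReal.toReal_mul, ← ENNReal.toReal_rpow, ENNReal.toReal_ofReal hδ.le,
      measureReal_def] using h3
  set R := 2 * K * ((k + δ) * M + H.toReal) with hR
  have hR0 : 0 ≤ R := by positivity
  have hexp : a1 ^ q = μ.real A ^ (q * (1 - 1 / s) - 1) := by
    rw [ha1, ← Real.rpow_mul measureReal_nonneg]
    congr 1
    field_simp
  have hδq : 0 < δ ^ q := by positivity
  rw [Real.div_rpow hR0 hδ.le, ← hexp, div_mul_eq_mul_div, le_div_iff₀ hδq, mul_comm]
  calc δ ^ q * μ.real {x | k + 2 * δ < u x} ≤ x ^ q := hcheb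
    _ ≤ (R * a1) ^ q := by gcongr
    _ = _ := Real.mul_rpow hR0 ha10

/-- The De Giorgi-Stampacchia bound: a positive function satisfying the energy inequality on all
level sets is essentially bounded. -/
lemma exists_eLpNorm_top_le {q s : ℝ} (hs : 0 < s) (hq : 0 < q)
    (hqs : 0 < 1 - 1 / s - 2 / q) (K M : ℝ≥0) : ∃ C : ℝ≥0, ∀ u c₁ c₂ : α → ℝ,
      MemLp u 2 μ → MemLp u (ENNReal.ofReal q) μ → (∀ᵐ x ∂μ, 0 < u x) →
      MemLp c₁ (ENNReal.ofReal s) μ → eLpNorm c₁ (ENNReal.ofReal s) μ ≤ M →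
      MemLp c₂ (ENNReal.ofReal s) μ →
      (∀ k δ : ℝ, 0 ≤ k → 0 < δ →
        eLpNorm (fun x => smoothTruncation k δ (u x)) (ENNReal.ofReal q) μ ^ 2 ≤
        K * ∫⁻ x, (‖c₁ x‖ₑ * ‖u x‖ₑ + ‖c₂ x‖ₑ) * ‖smoothTruncation k δ (u x)‖ₑ ∂μ) →
      eLpNorm u ∞ μ ≤ C * (eLpNorm u 2 μ + eLpNorm c₂ (ENNReal.ofReal s) μ) := by
  have hβ : 1 < q * (1 - 1 / s) - 1 := by
    have : q * (1 - 1 / s - 2 / q) = q * (1 - 1 / s) - 2 := by field_simp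
    nlinarith [mul_pos hq hqs]
  -- The constant `8 * K * (2 * M + 1)` is `2 * K * (2 * d * M + d)` divided by `d / 4`; the scale
  -- `d` cancels.
  obtain ⟨κ, hκ, hdecay⟩ := exists_pos_forall_tendsto_zero (8 * K * (2 * M + 1)) (K * M)
    (1 - 1 / s - 2 / q) q (q * (1 - 1 / s) - 1) (by positivity) hqs hq hβ
  -- With `κ * r ^ 2 = 1` and `d ≥ r * U`, Chebyshev in `L²` makes the first level set `{u > d}` of
  -- measure at most `κ`.
  set r : ℝ := (√κ)⁻¹ with hr
  have hr0 : 0 < r := by positivity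
  refine ⟨2 * (r.toNNReal + 1), fun u c₁ c₂ hu2 hu hu0 hc₁ hM hc₂ henergy => ?_⟩
  set U := (eLpNorm u 2 μ).toReal with hU
  set H := (eLpNorm c₂ (ENNReal.ofReal s) μ).toReal with hH
  have hU0 : 0 ≤ U := ENNReal.toReal_nonneg
  have hH0 : 0 ≤ H := ENNReal.toReal_nonneg
  set d : ℝ := r * U + H with hd
  have hd0 : 0 ≤ d := by positivity
  have hbound : ∀ᵐ x ∂μ, u x ≤ 2 * d := by
    -- The case `U = 0` is separated because `d` may then vanish.
    rcases hU0.eq_or_lt with h | h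
    · have h1 : eLpNorm u 2 μ = 0 := by
        rcases (ENNReal.toReal_eq_zero_iff _).1 h.symm with h | h
        · exact h
        · exact absurd h hu2.2.ne
      rw [eLpNorm_eq_zero_iff hu2.1 two_ne_zero] at h1
      filter_upwards [h1] with x hx
      rw [hx, Pi.zero_apply]
      positivity
    have hd1 : 0 < d := by positivity
    set k : ℕ → ℝ := fun n => d * (2 - (1 / 2) ^ n) with hk
    have hpow : ∀ n : ℕ, (0 : ℝ) < (1 / 2) ^ n ∧ ((1 / 2 : ℝ)) ^ n ≤ 1 := fun n =>
      ⟨by positivity, pow_le_one₀ (by norm_num) (by norm_num)⟩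
    have hcheb : μ.real {x | k 0 < u x} ≤ κ := by
      have h1 := mul_meas_ge_le_pow_eLpNorm' μ (p := 2) two_ne_zero ENNReal.ofNat_ne_top hu2.1
        (ENNReal.ofReal d)
      have h2 : μ {x | k 0 < u x} ≤ μ {x | ENNReal.ofReal d ≤ ‖u x‖ₑ} := by
        refine measure_mono fun x hx => ?_
        simp only [hk, Set.mem_ofPred_eq, pow_zero] at hx ⊢
        rw [Real.enorm_eq_ofReal (by linarith)]
        exact ENNReal.ofReal_le_ofReal (by linarith)
      have h3 := ENNReal.toReal_mono (ENNReal.rpow_ne_top_of_nonneg (by positivity) hu2.2.ne)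
        ((mul_le_mul_right h2 (ENNReal.ofReal d ^ (2 : ℝ≥0∞).toReal)).trans h1)
      simp only [ENNReal.toReal_mul, ← ENNReal.toReal_rpow, ENNReal.toReal_ofReal hd0,
        ENNReal.toReal_ofNat, Real.rpow_two, ← measureReal_def] at h3
      have h4 : U ^ 2 ≤ κ * d ^ 2 := by
        have h5 : κ * r ^ 2 = 1 := by
          rw [hr, inv_pow, Real.sq_sqrt hκ.le, mul_inv_cancel₀ hκ.ne']
        calc U ^ 2 = κ * (r * U) ^ 2 := by rw [mul_pow, ← mul_assoc, h5, one_mul]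
          _ ≤ κ * d ^ 2 := by
            gcongr
            linarith
      have h6 : d ^ 2 * μ.real {x | k 0 < u x} ≤ d ^ 2 * κ := by linarith
      exact le_of_mul_le_mul_left h6 (by positivity)
    have hlim := hdecay (fun n => μ.real {x | k n < u x}) (fun n => measureReal_nonneg) hcheb (by
      intro n hn
      obtain ⟨hp0, hp1⟩ := hpow n
      -- A quarter of `d / 2 ^ n`, so that two steps `δ` lead from `k n` to `k (n + 1)`.
      have hδ : 0 < d * (1 / 2) ^ n / 4 := by positivity
      have hkn : 0 ≤ k n := mul_nonneg hd0 (by linarith)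
      have h1 := measureReal_levelSet_le hs hq hqs hu hu0 hc₁ hM hc₂ hkn hδ
        (henergy _ _ hkn hδ) hn
      have h2 : k n + 2 * (d * (1 / 2) ^ n / 4) = k (n + 1) := by
        simp only [hk, pow_succ]; ring
      rw [h2] at h1
      refine h1.trans ?_
      refine mul_le_mul_of_nonneg_right ?_ (Real.rpow_nonneg measureReal_nonneg _)
      refine Real.rpow_le_rpow (by positivity) ?_ hq.le
      rw [div_le_iff₀ hδ]
      have h3 : k n + d * (1 / 2) ^ n / 4 ≤ 2 * d := by
        simp only [hk]; nlinarith
      have h4 : (2 : ℝ) ^ n * (1 / 2) ^ n = 1 := by rw [← mul_pow]; norm_num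
      have h5 : H ≤ d := by
        have : 0 ≤ r * U := by positivity
        linarith
      calc 2 * K * ((k n + d * (1 / 2) ^ n / 4) * M + H) ≤ 2 * K * ((2 * d) * M + d) := by gcongr
        _ = 2 * K * ((2 * d) * M + d) * ((2 : ℝ) ^ n * (1 / 2) ^ n) := by rw [h4, mul_one]
        _ = _ := by ring)
    have hzero : μ.real {x | 2 * d < u x} ≤ 0 := by
      refine ge_of_tendsto' hlim fun n => measureReal_mono fun x hx => ?_
      simp only [Set.mem_ofPred_eq, hk] at hx ⊢
      nlinarith [(hpow n).1]
    have hz : μ {x | 2 * d < u x} = 0 :=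
      (measureReal_eq_zero_iff).1 (le_antisymm hzero measureReal_nonneg)
    filter_upwards [measure_eq_zero_iff_ae_notMem.1 hz] with x hx
    exact not_lt.1 hx
  have htop : eLpNorm u ∞ μ ≤ ENNReal.ofReal (2 * d) := by
    rw [eLpNorm_exponent_top]
    refine eLpNormEssSup_le_of_ae_bound ?_
    filter_upwards [hbound, hu0] with x hx hx0
    rwa [Real.norm_of_nonneg hx0.le]
  refine htop.trans ?_
  rw [← ENNReal.ofReal_toReal hu2.2.ne, ← ENNReal.ofReal_toReal hc₂.2.ne, ← hU, ← hH,
    ← ENNReal.ofReal_add hU0 hH0, ← ENNReal.ofReal_coe_nnreal,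
    ← ENNReal.ofReal_mul NNReal.zero_le_coe]
  refine ENNReal.ofReal_le_ofReal ?_
  push_cast
  rw [Real.coe_toNNReal _ hr0.le, hd]
  nlinarith [mul_nonneg hr0.le hH0]

end LevelSets

/-! ### Energy inequality and bounds for weak solutions -/

section WeakSolutions

variable {N : ℕ} {D : Set (Metric.sphere (0 : EuclideanSpace ℝ (Fin N)) 1)}

/-- The Sobolev inequality combined with the weak formulation tested with `Φ(u)`. -/
lemma IsSmoothSphericalDomain.exists_energy_inequality (hN : 3 ≤ N)
    (hD : IsSmoothSphericalDomain D) : ∃ K : ℝ≥0, ∀ g u, IsPositiveWeakSolution D g u →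
      ∀ Φ : ℝ → ℝ, ContDiff ℝ 1 Φ → Φ 0 = 0 → (∀ s, 0 ≤ deriv Φ s) → (∀ s, deriv Φ s ≤ 1) →
      eLpNorm (fun x => Φ (u x)) (ENNReal.ofReal (sobolevExponent N)) (sectorMeasure D) ^ 2 ≤
        K * ∫⁻ x, ‖g x (u x)‖ₑ * ‖Φ (u x)‖ₑ ∂(sectorMeasure D) := by
  obtain ⟨C, hC⟩ := hD.exists_sobolev hN
  refine ⟨C ^ 2, fun g u ⟨Du, hu, _, hweak⟩ Φ hΦ hΦ0 hd0 hd1 => ?_⟩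
  have hcomp := hu.comp hΦ hΦ0 fun s => by rw [Real.norm_of_nonneg (hd0 s)]; exact hd1 s
  obtain ⟨hint, hzero⟩ := hweak _ _ hcomp
  obtain ⟨hu2, hDu2, -⟩ := hu
  set μ := sectorMeasure D
  have hinner : ∀ x, inner ℝ (Du x) (deriv Φ (u x) • Du x) = deriv Φ (u x) * ‖Du x‖ ^ 2 :=
    fun x => by rw [real_inner_smul_right, real_inner_self_eq_norm_sq]
  simp only [hinner] at hzero
  have hsq : Integrable (fun x => ‖Du x‖ ^ 2) μ := hDu2.integrable_norm_pow two_ne_zero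
  have hint' : Integrable (fun x => deriv Φ (u x) * ‖Du x‖ ^ 2) μ := by
    refine hsq.mono (((hΦ.continuous_deriv le_rfl).comp_aestronglyMeasurable hu2.1).mul hsq.1)
      (Eventually.of_forall fun x => ?_)
    rw [norm_mul, Real.norm_of_nonneg (hd0 _)]
    exact mul_le_of_le_one_left (norm_nonneg _) (hd1 _)
  rw [integral_sub hint' hint, sub_eq_zero] at hzero
  have h1 : eLpNorm (fun x => deriv Φ (u x) • Du x) 2 μ ^ 2 ≤
      ∫⁻ x, ‖g x (u x)‖ₑ * ‖Φ (u x)‖ₑ ∂μ := by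
    calc eLpNorm (fun x => deriv Φ (u x) • Du x) 2 μ ^ 2
        = ∫⁻ x, ‖deriv Φ (u x) • Du x‖ₑ ^ (2 : ℝ) ∂μ := by
          rw [eLpNorm_eq_lintegral_rpow_enorm_toReal two_ne_zero ENNReal.ofNat_ne_top,
            ENNReal.toReal_ofNat, ← ENNReal.rpow_two, ← ENNReal.rpow_mul]
          norm_num
      _ ≤ ∫⁻ x, ENNReal.ofReal (deriv Φ (u x) * ‖Du x‖ ^ 2) ∂μ := by
          refine lintegral_mono fun x => ?_
          rw [ENNReal.rpow_two, ← ofReal_norm, ← ENNReal.ofReal_pow (norm_nonneg _)]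
          refine ENNReal.ofReal_le_ofReal ?_
          rw [norm_smul, mul_pow, Real.norm_of_nonneg (hd0 _)]
          gcongr
          -- Slopes in `[0, 1]` satisfy `Φ'² ≤ Φ'`, so `‖∇Φ(u)‖²` is dominated by the energy `∫
          -- Φ'(u) |Du|²` of the tested equation.
          exact pow_le_of_le_one (hd0 _) (hd1 _) two_ne_zero
      _ = ENNReal.ofReal (∫ x, g x (u x) * Φ (u x) ∂μ) := by
          rw [← hzero, ofReal_integral_eq_lintegral_ofReal hint'
            (Eventually.of_forall fun x => mul_nonneg (hd0 _) (sq_nonneg _))]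
      _ ≤ ‖∫ x, g x (u x) * Φ (u x) ∂μ‖ₑ := Real.ofReal_le_enorm _
      _ ≤ ∫⁻ x, ‖g x (u x) * Φ (u x)‖ₑ ∂μ := enorm_integral_le_lintegral_enorm _
      _ = _ := by simp only [enorm_mul]
  calc eLpNorm (fun x => Φ (u x)) (ENNReal.ofReal (sobolevExponent N)) μ ^ 2
      ≤ (C * eLpNorm (fun x => deriv Φ (u x) • Du x) 2 μ) ^ 2 := by gcongr; exact hC _ _ hcomp
    _ = C ^ 2 * eLpNorm (fun x => deriv Φ (u x) • Du x) 2 μ ^ 2 := mul_pow _ _ _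
    _ ≤ _ := by push_cast; gcongr

lemma IsPositiveWeakSolution.memLp_two {g : EuclideanSpace ℝ (Fin N) → ℝ → ℝ}
    {u : EuclideanSpace ℝ (Fin N) → ℝ} (hu : IsPositiveWeakSolution D g u) :
    MemLp u 2 (sectorMeasure D) := by
  obtain ⟨Du, h, -⟩ := hu
  exact h.1

lemma IsPositiveWeakSolution.memLp_sobolevExponent (hN : 3 ≤ N) (hD : IsSmoothSphericalDomain D)
    {g : EuclideanSpace ℝ (Fin N) → ℝ → ℝ}
    {u : EuclideanSpace ℝ (Fin N) → ℝ} (hu : IsPositiveWeakSolution D g u) :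
    MemLp u (ENNReal.ofReal (sobolevExponent N)) (sectorMeasure D) := by
  obtain ⟨Du, h, -⟩ := hu
  obtain ⟨C, hC⟩ := hD.exists_sobolev hN
  exact ⟨h.1.1, (hC _ _ h).trans_lt (ENNReal.mul_lt_top ENNReal.coe_lt_top h.2.1.2)⟩

/-- The a priori bound with `c₂` measured in the same supercritical norm as `c₁`. -/
lemma IsSmoothSphericalDomain.exists_eLpNorm_top_le (hN : 3 ≤ N) (hD : IsSmoothSphericalDomain D)
    {s : ℝ} (hs : 0 < s) (hqs : 0 < 1 - 1 / s - 2 / sobolevExponent N) (M : ℝ≥0) :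
    ∃ C : ℝ≥0, ∀ (g : EuclideanSpace ℝ (Fin N) → ℝ → ℝ)
      (c₁ c₂ u : EuclideanSpace ℝ (Fin N) → ℝ),
        MemLp c₁ (ENNReal.ofReal s) (sectorMeasure D) →
        eLpNorm c₁ (ENNReal.ofReal s) (sectorMeasure D) ≤ M →
        MemLp c₂ (ENNReal.ofReal s) (sectorMeasure D) →
        IsPositiveWeakSolution D g u →
        (∀ᵐ x ∂(sectorMeasure D), |g x (u x)| ≤ c₁ x * |u x| + c₂ x) →
        eLpNorm u ∞ (sectorMeasure D) ≤
          C * (eLpNorm u 2 (sectorMeasure D) +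
            eLpNorm c₂ (ENNReal.ofReal s) (sectorMeasure D)) := by
  have := isFiniteMeasure_sectorMeasure D
  obtain ⟨K, hK⟩ := hD.exists_energy_inequality hN
  obtain ⟨C, hC⟩ := _root_.exists_eLpNorm_top_le (μ := sectorMeasure D) hs
    (sobolevExponent_pos hN) hqs K M
  refine ⟨C, fun g c₁ c₂ u hc₁ hM hc₂ hu hg => ?_⟩
  refine hC u c₁ c₂ hu.memLp_two (hu.memLp_sobolevExponent hN hD) (by obtain ⟨_, _, h, _⟩ := hu; exact h)
    hc₁ hM hc₂ fun k δ hk hδ => ?_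
  refine (hK g u hu _ (contDiff_smoothTruncation hδ) (smoothTruncation_of_le hδ hk)
    (deriv_smoothTruncation_nonneg hδ) (deriv_smoothTruncation_le_one hδ)).trans ?_
  refine mul_le_mul_right (lintegral_mono_ae ?_) _
  filter_upwards [hg] with x hx
  gcongr
  rw [← enorm_mul, ← ofReal_norm, ← ofReal_norm, ← ofReal_norm,
    ← ENNReal.ofReal_add (norm_nonneg _) (norm_nonneg _)]
  refine ENNReal.ofReal_le_ofReal (hx.trans ?_)
  rw [norm_mul, Real.norm_eq_abs, Real.norm_eq_abs, Real.norm_eq_abs]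
  gcongr <;> exact le_abs_self _

/-- A continuous function with `|f s| ≤ c |s| ^ p + b₀` for `s ≠ 0` grows at most like `s ^ (t + 1)`
on the half-line `s > 0` if `p ≤ t + 1`. -/
lemma exists_abs_le_rpow_mul_add {f : ℝ → ℝ} (hf : Continuous f) {c p b₀ t : ℝ}
    (hpt : p ≤ t + 1) (h : ∀ s : ℝ, s ≠ 0 → |f s| ≤ c * |s| ^ p + b₀) :
    ∃ B : ℝ, ∀ s : ℝ, 0 < s → |f s| ≤ |c| * s ^ t * s + B := by
  obtain ⟨K, hK⟩ := (isCompact_Icc (a := (0 : ℝ)) (b := 1)).exists_bound_of_continuousOn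
    hf.continuousOn
  refine ⟨max K b₀, fun s hs => ?_⟩
  rcases le_total s 1 with h1 | h1
  · have h2 : 0 ≤ |c| * s ^ t * s := by positivity
    have h3 : |f s| ≤ K := hK s ⟨hs.le, h1⟩
    linarith [le_max_left K b₀]
  · have h2 := h s hs.ne'
    rw [abs_of_pos hs] at h2
    have h3 : c * s ^ p ≤ |c| * s ^ t * s := by
      rw [mul_assoc, ← Real.rpow_add_one hs.ne']
      gcongr
      exact le_abs_self c
    linarith [le_max_right K b₀]

/-- Positive weak solutions with subcritical growth are bounded. -/
lemma IsPositiveWeakSolution.memLp_top_of_subcritical (hN : 3 ≤ N)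
    (hD : IsSmoothSphericalDomain D) {f : ℝ → ℝ} (hf : Continuous f) {c p b₀ : ℝ}
    (hp : p < ((N : ℝ) + 2) / ((N : ℝ) - 2))
    (hfb : ∀ s : ℝ, s ≠ 0 → |f s| ≤ c * |s| ^ p + b₀) {u : EuclideanSpace ℝ (Fin N) → ℝ}
    (hu : IsPositiveWeakSolution D (fun _ => f) u) : MemLp u ∞ (sectorMeasure D) := by
  have := isFiniteMeasure_sectorMeasure D
  have hN3 : (3 : ℝ) ≤ N := by exact_mod_cast hN
  have hm2 : (0 : ℝ) < N - 2 := by linarith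
  have hq := sobolevExponent_pos hN
  set q := sobolevExponent N with hqdef
  set e : ℝ := 4 / ((N : ℝ) - 2) with he
  have he0 : 0 < e := by positivity
  have hpe : p - 1 < e := by
    have : ((N : ℝ) + 2) / ((N : ℝ) - 2) - 1 = e := by rw [he]; field_simp; ring
    linarith
  set t : ℝ := max (p - 1) 0 with ht
  have ht0 : 0 ≤ t := le_max_right _ _
  have hte : t < e := max_lt hpe he0
  have hpt : p ≤ t + 1 := by linarith [le_max_left (p - 1) 0]
  -- The critical value `e = 4/(N-2)` corresponds to `s = q / e = N/2`. An exponent strictly between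
  -- `t` and `e` gives `s > N/2`, and is positive even when `t = 0`.
  set t' : ℝ := (t + e) / 2 with ht'
  have ht'0 : 0 < t' := by positivity
  have htt' : t ≤ t' := by linarith
  have ht'e : t' < e := by linarith
  set s : ℝ := q / t' with hs
  have hs0 : 0 < s := by positivity
  have hqs : 0 < 1 - 1 / s - 2 / q := by
    have h1 : e / q = 1 - 2 / q := by
      rw [hqdef, sobolevExponent, he]; field_simp; ring
    have h2 : 1 / s = t' / q := by rw [hs, one_div_div]
    have h3 : t' / q < e / q := by gcongr
    linarith
  obtain ⟨B, hB⟩ := exists_abs_le_rpow_mul_add hf hpt hfb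
  have huq := hu.memLp_sobolevExponent hN hD
  have hc₁ : MemLp (fun x => |c| * ‖u x‖ ^ t) (ENNReal.ofReal s) (sectorMeasure D) := by
    refine MemLp.const_mul ?_ _
    -- For `t = 0` the exponent `q / t` is `∞` in `ℝ≥0∞`, so the case needs no separate treatment.
    have h1 := huq.norm_rpow_div (ENNReal.ofReal t)
    rw [ENNReal.toReal_ofReal ht0] at h1
    refine h1.mono_exponent ?_
    rw [ENNReal.le_div_iff_mul_le (Or.inr (by simpa using hq)) (Or.inl ENNReal.ofReal_ne_top),
      ← ENNReal.ofReal_mul hs0.le]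
    refine ENNReal.ofReal_le_ofReal ?_
    calc s * t ≤ s * t' := by gcongr
      _ = q := by rw [hs]; field_simp
  -- Here the constant depends on `u` through the norm of `c₁`, which is harmless for a qualitative
  -- statement.
  obtain ⟨C, hC⟩ := hD.exists_eLpNorm_top_le hN hs0 hqs
    (eLpNorm (fun x => |c| * ‖u x‖ ^ t) (ENNReal.ofReal s) (sectorMeasure D)).toNNReal
  have hB' : MemLp (fun _ : EuclideanSpace ℝ (Fin N) => B) (ENNReal.ofReal s)
      (sectorMeasure D) := memLp_const B
  have hbound := hC (fun _ => f) _ (fun _ => B) u hc₁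
    (ENNReal.coe_toNNReal hc₁.2.ne).ge hB' hu (by
      obtain ⟨_, _, hpos, _⟩ := hu
      filter_upwards [hpos] with x hx
      rw [Real.norm_of_nonneg hx.le, abs_of_pos hx]
      exact hB _ hx)
  exact ⟨hu.memLp_two.1, hbound.trans_lt (ENNReal.mul_lt_top ENNReal.coe_lt_top
    (ENNReal.add_lt_top.2 ⟨hu.memLp_two.2, hB'.2⟩))⟩

end WeakSolutions


/-! ### The proposition -/

theorem proposition3p1 (N : ℕ) (hN : 3 ≤ N)
    (D : Set (Metric.sphere (0 : EuclideanSpace ℝ (Fin N)) 1))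
    (hD : IsSmoothSphericalDomain D) (ε : ℝ) (hε0 : 0 < ε) (hε2 : ε < 2) :
    (∀ M : ℝ≥0, ∃ C : ℝ≥0,
      ∀ (g : EuclideanSpace ℝ (Fin N) → ℝ → ℝ) (c₁ c₂ u : EuclideanSpace ℝ (Fin N) → ℝ),
        MemLp c₁ (ENNReal.ofReal (N / (2 - ε))) (sectorMeasure D) →
        eLpNorm c₁ (ENNReal.ofReal (N / (2 - ε))) (sectorMeasure D) ≤ M →
        MemLp c₂ (ENNReal.ofReal (N / (2 - ε))) (sectorMeasure D) →
        IsPositiveWeakSolution D g u →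
        (∀ᵐ x ∂(sectorMeasure D), |g x (u x)| ≤ c₁ x * |u x| + c₂ x) →
        MemLp u ∞ (sectorMeasure D) ∧
        eLpNorm u ∞ (sectorMeasure D) ≤
          C * (eLpNorm u 2 (sectorMeasure D) + eLpNorm c₂ ∞ (sectorMeasure D))) ∧
    (∀ (f : ℝ → ℝ) (c p : ℝ) (b u : EuclideanSpace ℝ (Fin N) → ℝ),
        Continuous f →
        p < ((N : ℝ) + 2) / ((N : ℝ) - 2) →
        MemLp b (ENNReal.ofReal (N / (2 - ε))) (sectorMeasure D) →
        (∀ᵐ x ∂(sectorMeasure D), ∀ s : ℝ, s ≠ 0 → |f s| ≤ c * |s| ^ p + b x) →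
        IsPositiveWeakSolution D (fun _ => f) u →
        MemLp u ∞ (sectorMeasure D)) := by
  have hN3 : (3 : ℝ) ≤ N := by exact_mod_cast hN
  have := isFiniteMeasure_sectorMeasure D
  have h2ε : 0 < 2 - ε := by linarith
  have hs : 0 < (N : ℝ) / (2 - ε) := by positivity
  refine ⟨fun M => ?_, fun f c p b u hf hp _ hfb hu => ?_⟩
  · have hqs : 0 < 1 - 1 / ((N : ℝ) / (2 - ε)) - 2 / sobolevExponent N := by
      have hm2 : (0 : ℝ) < N - 2 := by linarith
      have h1 : 1 - 1 / ((N : ℝ) / (2 - ε)) - 2 / sobolevExponent N = ε / N := by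
        rw [sobolevExponent]; field_simp; ring
      rw [h1]; positivity
    obtain ⟨C, hC⟩ := hD.exists_eLpNorm_top_le hN hs hqs M
    -- The Hölder factor from `L^∞` to `L^s` on a finite measure space. The bound with `‖c₂‖_s`
    -- comes first, since it yields `u ∈ L^∞` even for unbounded `c₂`.
    set T : ℝ≥0∞ := sectorMeasure D Set.univ ^ (1 / ((N : ℝ) / (2 - ε))) with hT
    have hTtop : T ≠ ⊤ := ENNReal.rpow_ne_top_of_nonneg (by positivity) (measure_ne_top _ _)
    refine ⟨C * (1 + T.toNNReal), fun g c₁ c₂ u hc₁ hM hc₂ hu hg => ?_⟩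
    have hbound := hC g c₁ c₂ u hc₁ hM hc₂ hu hg
    refine ⟨⟨hu.memLp_two.1, hbound.trans_lt (ENNReal.mul_lt_top ENNReal.coe_lt_top
      (ENNReal.add_lt_top.2 ⟨hu.memLp_two.2, hc₂.2⟩))⟩, hbound.trans ?_⟩
    have hc₂T : eLpNorm c₂ (ENNReal.ofReal (N / (2 - ε))) (sectorMeasure D) ≤
        eLpNorm c₂ ∞ (sectorMeasure D) * T := by
      have h1 := eLpNorm_le_eLpNorm_mul_rpow_measure_univ
        (le_top : ENNReal.ofReal ((N : ℝ) / (2 - ε)) ≤ ⊤) hc₂.1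
      -- The conventions `∞.toReal = 0` and `1 / 0 = 0` give the correct exponent `1 / s - 0`.
      rw [ENNReal.toReal_ofReal hs.le, ENNReal.toReal_top, div_zero, sub_zero] at h1
      exact h1
    push_cast
    rw [ENNReal.coe_toNNReal hTtop, mul_assoc]
    gcongr
    calc eLpNorm u 2 (sectorMeasure D) +
          eLpNorm c₂ (ENNReal.ofReal (N / (2 - ε))) (sectorMeasure D)
        ≤ 1 * eLpNorm u 2 (sectorMeasure D) + T * eLpNorm c₂ ∞ (sectorMeasure D) := by
          rw [one_mul, mul_comm T]
          gcongr
      _ ≤ (1 + T) * eLpNorm u 2 (sectorMeasure D) +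
          (1 + T) * eLpNorm c₂ ∞ (sectorMeasure D) := by
          gcongr
          · exact le_self_add
          · exact le_add_self
      _ = _ := by rw [mul_add]
  · rcases eq_or_ne (sectorMeasure D) 0 with h0 | h0
    · rw [h0]
      exact ⟨aestronglyMeasurable_zero_measure u, by simp⟩
    -- Since `f` does not depend on `x`, the growth condition at a single good point `x₀` suffices,
    -- with the constant `b x₀` in place of `b`.
    · have : (ae (sectorMeasure D)).NeBot := ae_neBot.2 h0
      obtain ⟨x₀, hx₀⟩ := hfb.exists
      exact hu.memLp_top_of_subcritical hN hD hf hp hx₀
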